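/- **Theorem 4.1.** Let $K$ be a field and $V$ a vector space over $K$. An *associative trialgebra* over $K$ is a $K$-vector space $A$ with three bilinear operations $\dashv,\vdash,\perp$ satisfying, for all $x,y,z\in A$, the eleven relations $$(x\dashv y)\dashv z=x\dashv(y\dashv z)=x\dashv(y\vdash z)=x\dashv(y\perp z),$$ $$(x\dashv y)\vdash z=(x\vdash y)\vdash z=(x\perp y)\vdash z=x\vdash(y\vdash z),$$ $$(x\vdash y)\dashv z=x\vdash(y\dashv z),\quad (x\perp y)\dashv z=x\perp(y\dashv z),\quad (x\dashv y)\perp z=x\perp(y\vdash z),$$ $$(x\vdash y)\perp z=x\vdash(y\perp z),\quad (x\perp y)\perp z=x\perp(y\perp z).$$ Morphisms are the linear maps compatible with the three operations. The *free associative trialgebra* on $V$ is an associative trialgebra $Trias(V)$ with a linear map $\iota:V\to Trias(V)$ such that every linear map from $V$ to an associative trialgebra $B$ extends along $\iota$ to a unique morphism $Trias(V)\to B$. Let $T_n$ be the set of planar rooted trees with $n+1$ leaves, numbered $0,\dots,n$ from left to right, in which every internal vertex has at least two children. The chain complex $C_*^{Trias}(A)$ of an associative trialgebra $A$ is $$C_n^{Trias}(A)=K[T_n]\otimes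 A^{\otimes n}\quad(n\ge 1),\qquad C_0^{Trias}(A)=0,\qquad d=\sum_{i=1}^{n-1}(-1)^i d_i:C_n^{Trias}(A)\to C_{n-1}^{Trias}(A)\quad(n\ge 2),$$ $$d_i(t;a_1,\dots,a_n)=(d_i(t);a_1,\dots,a_i\circ_i^t a_{i+1},\dots,a_n),$$ where $d_i(t)$ is obtained from $t$ by deleting the $i$-th leaf (and, if its parent vertex is left with one child only, suppressing that vertex), and where $\circ_i^t$ is $\dashv$, $\vdash$ or $\perp$ according to whether the $i$-th leaf is the leftmost child of its parent vertex, the rightmost child, or neither. Let $H_n^{Trias}(A)$ be the homology of this complex in degree $n$. Then $$H_n^{Trias}(Trias(V))\cong\begin{cases}V & \text{if } n=1,\\ 0&\text{otherwise,}\end{cases}$$ where for $n=1$ the isomorphism sends $v\in V$ to the class of $(Y;\iota(v))$, with $Y$ the unique tree in $T_1$. -/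

import Mathlib

open TensorProduct

universe u v w

namespace Trias

/-- The three possible positions of a child at a vertex of a planar tree: leftmost, rightmost or
neither. A leaf is called left, right or middle according to its position at its parent. -/
inductive Side where
  | left
  | middle
  | right

mutual

/-- Planar rooted trees in which each internal vertex has at least two children: a tree is either
a single edge `|` (one leaf, no vertex), or `node t f`, a root vertex whose first child is `t` and
whose other children, read from left to right, form the nonempty sequence `f`. -/
inductive PTree : Type where
  | leaf : PTree
  | node : PTree → PForest → PTree

/-- Nonempty finite sequences of planar trees. -/
inductive PForest : Type where
  | one : PTree → PForest
  | cons : PTree → PForest → PForest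

end

mutual

/-- The number of leaves of a tree. -/
def PTree.leaves : PTree → ℕ
  | .leaf => 1
  | .node t f => t.leaves + f.leaves

/-- The total number of leaves of a sequence of trees. -/
def PForest.leaves : PForest → ℕ
  | .one t => t.leaves
  | .cons t f => t.leaves + f.leaves

end

/-- The tree left at a vertex whose remaining children are the sequence `f`: if only one child
remains, the vertex disappears and the child takes its place. -/
def PForest.graft : PForest → PTree
  | .one t => t
  | .cons t f => .node t f

mutual

/-- Delete the `i`-th leaf, the leaves being numbered from left to right starting with `0`. If the
parent vertex is left with a single child, it disappears and that child takes its place. Nothing is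
left (`none`) when the tree consists of one leaf. Only used for `i < t.leaves`. -/
def PTree.del : PTree → ℕ → Option PTree
  | .leaf, _ => none
  | .node t f, i =>
    if i < t.leaves then
      match t.del i with
      | none => some f.graft
      | some t' => some (.node t' f)
    else
      match f.del (i - t.leaves) with
      | none => some t
      | some f' => some (.node t f')

/-- Delete the `i`-th leaf of a sequence of trees, numbered from left to right starting with `0`;
a tree consisting of this leaf only disappears from the sequence. -/
def PForest.del : PForest → ℕ → Option PForest
  | .one t, i =>
    match t.del i with
    | none => none
    | some t' => some (.one t')
  | .cons t f, i =>
    if i < t.leaves then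
      match t.del i with
      | none => some f
      | some t' => some (.cons t' f)
    else
      match f.del (i - t.leaves) with
      | none => some (.one t)
      | some f' => some (.cons t f')

end

mutual

/-- The position (left, middle, right) of the `i`-th leaf at its parent vertex, leaves being
numbered from left to right starting with `0`. The argument of type `Side` is the position of the
root of the tree itself inside a bigger tree; it matters only for the tree `|`. -/
def PTree.side : Side → PTree → ℕ → Side
  | s, .leaf, _ => s
  | _, .node t f, i =>
    if i < t.leaves then t.side .left i else f.side (i - t.leaves)

/-- The position of the `i`-th leaf of the sequence of all children of some vertex but the first
one: the last tree of the sequence is the rightmost child, all others are middle children. -/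
def PForest.side : PForest → ℕ → Side
  | .one t, i => t.side .right i
  | .cons t f, i =>
    if i < t.leaves then t.side .middle i else f.side (i - t.leaves)

end

mutual

theorem PTree.leaves_pos : (t : PTree) → 0 < t.leaves
  | .leaf => by simp [PTree.leaves]
  | .node t f => by have := t.leaves_pos; simp only [PTree.leaves]; omega

theorem PForest.leaves_pos : (f : PForest) → 0 < f.leaves
  | .one t => by simpa only [PForest.leaves] using t.leaves_pos
  | .cons t f => by have := t.leaves_pos; simp only [PForest.leaves]; omega

end

@[simp] theorem PForest.leaves_graft (f : PForest) : f.graft.leaves = f.leaves := by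
  cases f <;> simp [PForest.graft, PTree.leaves, PForest.leaves]

mutual

theorem PTree.leaves_del : (t : PTree) → (i : ℕ) →
    t.leaves = (t.del i).elim 0 PTree.leaves + 1
  | .leaf, i => by simp [PTree.leaves, PTree.del]
  | .node t f, i => by
    have h1 := t.leaves_del i
    have h2 := f.leaves_del (i - t.leaves)
    simp only [PTree.leaves, PTree.del]
    rcases h : t.del i <;> rcases h' : f.del (i - t.leaves) <;> split_ifs <;>
      simp_all [PTree.leaves] <;> omega

theorem PForest.leaves_del : (f : PForest) → (i : ℕ) →
    f.leaves = (f.del i).elim 0 PForest.leaves + 1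
  | .one t, i => by
    have h1 := t.leaves_del i
    simp only [PForest.leaves, PForest.del]
    rcases h : t.del i <;> simp_all [PForest.leaves]
  | .cons t f, i => by
    have h1 := t.leaves_del i
    have h2 := f.leaves_del (i - t.leaves)
    simp only [PForest.leaves, PForest.del]
    rcases h : t.del i <;> rcases h' : f.del (i - t.leaves) <;> split_ifs <;>
      simp_all [PForest.leaves] <;> omega

end

/-- The quadruples of operations for which `(x ∘ₚ y) ∘_q z = x ∘_r (y ∘ₛ z)` is one of the eleven
relations of associative trialgebras. -/
def Compat (p q r s : Side) : Prop := match p, q, r, s with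
  | .left, .left, .left, _ => True
  | .right, .left, .right, .left => True
  | _, .right, .right, .right => True
  | .middle, .left, .middle, .left => True
  | .left, .middle, .middle, .right => True
  | .right, .middle, .right, .middle => True
  | .middle, .middle, .middle, .middle => True
  | _, _, _, _ => False


theorem PTree.leaves_of_del_none {t : PTree} {i : ℕ} (h : t.del i = none) : t = .leaf := by
  cases t with
  | leaf => rfl
  | node t f =>
    have := PTree.leaves_del (.node t f) i
    have := t.leaves_pos
    have := f.leaves_pos
    simp_all [PTree.leaves]
    omega

theorem PTree.leaves_of_del_some {t t' : PTree} {i : ℕ} (h : t.del i = some t') :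
    t.leaves = t'.leaves + 1 := by
  simpa [h] using t.leaves_del i

theorem PForest.leaves_of_del_some {f f' : PForest} {i : ℕ} (h : f.del i = some f') :
    f.leaves = f'.leaves + 1 := by
  simpa [h] using f.leaves_del i

theorem PForest.leaves_of_del_none {f : PForest} {i : ℕ} (h : f.del i = none) :
    f = .one .leaf := by
  have h1 := f.leaves_del i
  cases f with
  | one t =>
    cases t with
    | leaf => rfl
    | node t f =>
      have := t.leaves_pos
      have := f.leaves_pos
      simp_all [PTree.leaves, PForest.leaves]
      omega
  | cons t f =>
    have := t.leaves_pos
    have := f.leaves_pos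
    simp_all [PForest.leaves]
    omega

theorem PForest.del_graft (f : PForest) (i : ℕ) : f.graft.del i = (f.del i).map PForest.graft := by
  cases f with
  | one t => simp only [PForest.graft, PForest.del]; cases t.del i <;> rfl
  | cons t f =>
    simp only [PForest.graft, PForest.del, PTree.del]
    split_ifs
    · cases t.del i <;> rfl
    · cases f.del (i - t.leaves) <;> rfl

mutual

theorem PTree.del_del : (t : PTree) → (i j : ℕ) → i < j → j < t.leaves →
    (t.del j).bind (PTree.del · i) = (t.del i).bind (PTree.del · (j - 1))
  | .leaf, i, j, _, _ => by simp [PTree.del]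
  | .node t f, i, j, hij, hj => by
    have ht := t.leaves_pos
    have hf := f.leaves_pos
    simp only [PTree.leaves] at hj
    by_cases h1 : j < t.leaves
    · have ih := t.del_del i j hij h1
      have h2 : i < t.leaves := by omega
      rcases h3 : t.del j with _ | b
      · have := PTree.leaves_of_del_none h3; subst this; simp [PTree.leaves] at h1; omega
      rcases h4 : t.del i with _ | a
      · have := PTree.leaves_of_del_none h4; subst this; simp [PTree.leaves] at h1; omega
      have h5 := PTree.leaves_of_del_some h3
      have h6 := PTree.leaves_of_del_some h4
      simp only [h3, h4, Option.bind_some] at ih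
      have h7 : i < b.leaves := by omega
      have h8 : j - 1 < a.leaves := by omega
      simp [PTree.del, h1, h2, h3, h4, h7, h8, ih]
    · by_cases h2 : i < t.leaves
      · rcases h3 : f.del (j - t.leaves) with _ | f'
        · have := PForest.leaves_of_del_none h3; subst this
          rcases h4 : t.del i with _ | a
          · have := PTree.leaves_of_del_none h4; subst this
            simp [PTree.del, h1, h2, h3, PForest.graft]
          · have h6 := PTree.leaves_of_del_some h4
            have h8 : ¬ (j - 1 < a.leaves) := by omega
            simp [PTree.del, h1, h2, h4, h8, PForest.del]
        · rcases h4 : t.del i with _ | a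
          · have := PTree.leaves_of_del_none h4; subst this
            simp only [PTree.leaves] at h1 h2 h3
            simp [PTree.del, h1, h2, h3, PTree.leaves, PForest.del_graft]
          · have h6 := PTree.leaves_of_del_some h4
            have h8 : ¬ (j - 1 < a.leaves) := by omega
            have h9 : j - 1 - a.leaves = j - t.leaves := by omega
            simp [PTree.del, h1, h2, h3, h4, h8, h9]
      · have ih := f.del_del (i - t.leaves) (j - t.leaves) (by omega) (by omega)
        have h9 : j - 1 - t.leaves = j - t.leaves - 1 := by omega
        have h10 : ¬ (j - 1 < t.leaves) := by omega
        rcases h3 : f.del (j - t.leaves) with _ | b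
        · have := PForest.leaves_of_del_none h3; subst this
          simp [PTree.leaves, PForest.leaves] at hj; omega
        rcases h4 : f.del (i - t.leaves) with _ | a
        · have := PForest.leaves_of_del_none h4; subst this
          simp [PTree.leaves, PForest.leaves] at hj; omega
        simp only [h3, h4, Option.bind_some] at ih
        simp [PTree.del, h1, h2, h3, h4, h10, h9, ih]

theorem PForest.del_del : (f : PForest) → (i j : ℕ) → i < j → j < f.leaves →
    (f.del j).bind (PForest.del · i) = (f.del i).bind (PForest.del · (j - 1))
  | .one t, i, j, hij, hj => by
    have ih := t.del_del i j hij (by simpa [PForest.leaves] using hj)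
    simp only [PForest.leaves] at hj
    rcases h3 : t.del j with _ | b
    · have := PTree.leaves_of_del_none h3; subst this; simp [PTree.leaves] at hj; omega
    rcases h4 : t.del i with _ | a
    · have := PTree.leaves_of_del_none h4; subst this; simp [PTree.leaves] at hj; omega
    simp only [h3, h4, Option.bind_some] at ih
    simp [PForest.del, h3, h4, ih]
  | .cons t f, i, j, hij, hj => by
    have ht := t.leaves_pos
    have hf := f.leaves_pos
    simp only [PForest.leaves] at hj
    by_cases h1 : j < t.leaves
    · have ih := t.del_del i j hij h1
      have h2 : i < t.leaves := by omega
      rcases h3 : t.del j with _ | b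
      · have := PTree.leaves_of_del_none h3; subst this; simp [PTree.leaves] at h1; omega
      rcases h4 : t.del i with _ | a
      · have := PTree.leaves_of_del_none h4; subst this; simp [PTree.leaves] at h1; omega
      have h5 := PTree.leaves_of_del_some h3
      have h6 := PTree.leaves_of_del_some h4
      simp only [h3, h4, Option.bind_some] at ih
      have h7 : i < b.leaves := by omega
      have h8 : j - 1 < a.leaves := by omega
      simp [PForest.del, h1, h2, h3, h4, h7, h8, ih]
    · by_cases h2 : i < t.leaves
      · rcases h3 : f.del (j - t.leaves) with _ | f'
        · have := PForest.leaves_of_del_none h3; subst this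
          rcases h4 : t.del i with _ | a
          · have := PTree.leaves_of_del_none h4; subst this
            simp [PForest.del, PTree.del, h1, h2]
          · have h6 := PTree.leaves_of_del_some h4
            have h8 : ¬ (j - 1 < a.leaves) := by omega
            simp [PTree.del, h1, h2, h4, h8, PForest.del]
        · rcases h4 : t.del i with _ | a
          · have := PTree.leaves_of_del_none h4; subst this
            simp only [PTree.leaves] at h1 h2 h3
            simp [PForest.del, PTree.del, h1, h2, h3, PTree.leaves]
          · have h6 := PTree.leaves_of_del_some h4
            have h8 : ¬ (j - 1 < a.leaves) := by omega
            have h9 : j - 1 - a.leaves = j - t.leaves := by omega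
            simp [PForest.del, h1, h2, h3, h4, h8, h9]
      · have ih := f.del_del (i - t.leaves) (j - t.leaves) (by omega) (by omega)
        have h9 : j - 1 - t.leaves = j - t.leaves - 1 := by omega
        have h10 : ¬ (j - 1 < t.leaves) := by omega
        rcases h3 : f.del (j - t.leaves) with _ | b
        · have := PForest.leaves_of_del_none h3; subst this
          simp [PTree.leaves, PForest.leaves] at hj; omega
        rcases h4 : f.del (i - t.leaves) with _ | a
        · have := PForest.leaves_of_del_none h4; subst this
          simp [PTree.leaves, PForest.leaves] at hj; omega
        simp only [h3, h4, Option.bind_some] at ih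
        simp [PForest.del, h1, h2, h3, h4, h10, h9, ih]

end

theorem PTree.side_congr (t : PTree) (s s' : Side) (i : ℕ) (h : 2 ≤ t.leaves) :
    t.side s i = t.side s' i := by
  cases t with
  | leaf => simp [PTree.leaves] at h
  | node t f => simp only [PTree.side]

theorem PTree.side_left_zero : (t : PTree) → t.side .left 0 = .left
  | .leaf => by simp only [PTree.side]
  | .node t f => by simp only [PTree.side, t.leaves_pos, if_true, t.side_left_zero]

theorem PTree.side_node_zero (t : PTree) (f : PForest) (s : Side) :
    (PTree.node t f).side s 0 = .left := by
  simp only [PTree.side, t.leaves_pos, if_true, t.side_left_zero]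

mutual

theorem PTree.side_right_last : (t : PTree) → (i : ℕ) → i + 1 = t.leaves → t.side .right i = .right
  | .leaf, _, _ => by simp only [PTree.side]
  | .node t f, i, h => by
    have := f.leaves_pos
    simp only [PTree.leaves] at h
    have h1 : ¬ (i < t.leaves) := by omega
    simp only [PTree.side, h1, if_false]
    exact f.side_last _ (by omega)

theorem PForest.side_last : (f : PForest) → (i : ℕ) → i + 1 = f.leaves → f.side i = .right
  | .one t, i, h => by
    simp only [PForest.leaves] at h
    simpa only [PForest.side] using t.side_right_last i h
  | .cons t f, i, h => by
    have := f.leaves_pos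
    simp only [PForest.leaves] at h
    have h1 : ¬ (i < t.leaves) := by omega
    simp only [PForest.side, h1, if_false]
    exact f.side_last _ (by omega)

end

theorem PTree.side_node_last (t : PTree) (f : PForest) (s : Side) (i : ℕ)
    (h : i + 1 = (PTree.node t f).leaves) : (PTree.node t f).side s i = .right := by
  rw [PTree.side_congr _ s .right _ (by
    have := t.leaves_pos; have := f.leaves_pos; simp only [PTree.leaves]; omega)]
  exact PTree.side_right_last _ _ h

theorem PForest.side_graft (f : PForest) (s : Side) (i : ℕ) (h1 : 1 ≤ i) (h2 : i < f.leaves) :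
    f.graft.side s i = f.side i := by
  cases f with
  | one t =>
    simp only [PForest.leaves] at h2
    simp only [PForest.graft, PForest.side]
    exact t.side_congr _ _ _ (by omega)
  | cons t f =>
    simp only [PForest.graft, PForest.side, PTree.side]
    split_ifs
    · exact t.side_congr _ _ _ (by omega)
    · rfl

theorem PTree.exists_del {t : PTree} (h : 2 ≤ t.leaves) (i : ℕ) :
    ∃ t', t.del i = some t' ∧ t.leaves = t'.leaves + 1 := by
  rcases h' : t.del i with _ | t'
  · rw [PTree.leaves_of_del_none h'] at h; simp [PTree.leaves] at h
  · exact ⟨t', rfl, PTree.leaves_of_del_some h'⟩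

theorem PForest.exists_del {f : PForest} (h : 2 ≤ f.leaves) (i : ℕ) :
    ∃ f', f.del i = some f' ∧ f.leaves = f'.leaves + 1 := by
  rcases h' : f.del i with _ | t'
  · rw [PForest.leaves_of_del_none h'] at h; simp [PTree.leaves, PForest.leaves] at h
  · exact ⟨t', rfl, PForest.leaves_of_del_some h'⟩

mutual

theorem PTree.side_del_of_lt : (t t' : PTree) → (s : Side) → (i j : ℕ) → i + 1 < j → j < t.leaves →
    t.del j = some t' → t'.side s i = t.side s i
  | .leaf, _, _, _, _, _, _, h => by simp [PTree.del] at h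
  | .node t f, t', s, i, j, hij, hj, h => by
    simp only [PTree.leaves] at hj
    simp only [PTree.del] at h
    by_cases h1 : j < t.leaves
    · obtain ⟨b, hb, hb'⟩ := PTree.exists_del (t := t) (by omega) j
      simp only [h1, if_true, hb, Option.some.injEq] at h
      subst h
      have h2 : i < b.leaves := by omega
      have h3 : i < t.leaves := by omega
      simp only [PTree.side, h2, h3, if_true]
      exact t.side_del_of_lt b _ i j hij h1 hb
    · rcases hb : f.del (j - t.leaves) with _ | b
      · simp only [h1, if_false, hb, Option.some.injEq] at h
        subst h
        have := PForest.leaves_of_del_none hb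
        subst this
        simp only [PForest.leaves, PTree.leaves] at hj
        have h3 : i < t.leaves := by omega
        simp only [PTree.side, h3, if_true]
        exact t.side_congr _ _ _ (by omega)
      · simp only [h1, if_false, hb, Option.some.injEq] at h
        subst h
        simp only [PTree.side]
        split_ifs
        · rfl
        · exact f.side_del_of_lt b _ (j - t.leaves) (by omega) (by omega) hb

theorem PForest.side_del_of_lt : (f f' : PForest) → (i j : ℕ) → i + 1 < j → j < f.leaves →
    f.del j = some f' → f'.side i = f.side i
  | .one t, f', i, j, hij, hj, h => by
    simp only [PForest.leaves] at hj
    simp only [PForest.del] at h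
    obtain ⟨b, hb, hb'⟩ := PTree.exists_del (t := t) (by omega) j
    simp only [hb, Option.some.injEq] at h
    subst h
    simp only [PForest.side]
    exact t.side_del_of_lt b _ i j hij hj hb
  | .cons t f, t', i, j, hij, hj, h => by
    simp only [PForest.leaves] at hj
    simp only [PForest.del] at h
    by_cases h1 : j < t.leaves
    · obtain ⟨b, hb, hb'⟩ := PTree.exists_del (t := t) (by omega) j
      simp only [h1, if_true, hb, Option.some.injEq] at h
      subst h
      have h2 : i < b.leaves := by omega
      have h3 : i < t.leaves := by omega
      simp only [PForest.side, h2, h3, if_true]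
      exact t.side_del_of_lt b _ i j hij h1 hb
    · rcases hb : f.del (j - t.leaves) with _ | b
      · simp only [h1, if_false, hb, Option.some.injEq] at h
        subst h
        have := PForest.leaves_of_del_none hb
        subst this
        simp only [PTree.leaves, PForest.leaves] at hj
        have h3 : i < t.leaves := by omega
        simp only [PForest.side, h3, if_true]
        exact t.side_congr _ _ _ (by omega)
      · simp only [h1, if_false, hb, Option.some.injEq] at h
        subst h
        simp only [PForest.side]
        split_ifs
        · rfl
        · exact f.side_del_of_lt b _ (j - t.leaves) (by omega) (by omega) hb

end

mutual

theorem PTree.side_del_of_gt : (t t' : PTree) → (s : Side) → (i j : ℕ) → i + 1 < j → j < t.leaves →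
    t.del i = some t' → t'.side s (j - 1) = t.side s j
  | .leaf, _, _, _, _, _, _, h => by simp [PTree.del] at h
  | .node t f, t', s, i, j, hij, hj, h => by
    simp only [PTree.leaves] at hj
    simp only [PTree.del] at h
    by_cases h0 : i < t.leaves
    · rcases ha : t.del i with _ | a
      · simp only [h0, if_true, ha, Option.some.injEq] at h
        subst h
        have := PTree.leaves_of_del_none ha
        subst this
        simp only [PTree.leaves] at h0 hj
        have h1 : ¬ (j < PTree.leaf.leaves) := by simp only [PTree.leaves]; omega
        rw [PForest.side_graft _ _ _ (by omega) (by omega)]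
        simp only [PTree.side, h1, if_false]
        rfl
      · have h4 := PTree.leaves_of_del_some ha
        simp only [h0, if_true, ha, Option.some.injEq] at h
        subst h
        by_cases h1 : j < t.leaves
        · have h2 : j - 1 < a.leaves := by omega
          simp only [PTree.side, h1, h2, if_true]
          exact t.side_del_of_gt a _ i j hij h1 ha
        · have h2 : ¬ (j - 1 < a.leaves) := by omega
          have h3 : j - 1 - a.leaves = j - t.leaves := by omega
          simp only [PTree.side, h1, h2, h3, if_false]
    · obtain ⟨a, ha, h4⟩ := PForest.exists_del (f := f) (by omega) (i - t.leaves)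
      simp only [h0, if_false, ha, Option.some.injEq] at h
      subst h
      have h1 : ¬ (j < t.leaves) := by omega
      have h2 : ¬ (j - 1 < t.leaves) := by omega
      have h3 : j - 1 - t.leaves = j - t.leaves - 1 := by omega
      simp only [PTree.side, h1, h2, h3, if_false]
      exact f.side_del_of_gt a _ _ (by omega) (by omega) ha

theorem PForest.side_del_of_gt : (f f' : PForest) → (i j : ℕ) → i + 1 < j → j < f.leaves →
    f.del i = some f' → f'.side (j - 1) = f.side j
  | .one t, f', i, j, hij, hj, h => by
    simp only [PForest.leaves] at hj
    simp only [PForest.del] at h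
    obtain ⟨b, hb, hb'⟩ := PTree.exists_del (t := t) (by omega) i
    simp only [hb, Option.some.injEq] at h
    subst h
    simp only [PForest.side]
    exact t.side_del_of_gt b _ i j hij hj hb
  | .cons t f, t', i, j, hij, hj, h => by
    simp only [PForest.leaves] at hj
    simp only [PForest.del] at h
    by_cases h0 : i < t.leaves
    · rcases ha : t.del i with _ | a
      · simp only [h0, if_true, ha, Option.some.injEq] at h
        subst h
        have := PTree.leaves_of_del_none ha
        subst this
        simp only [PTree.leaves] at h0 hj
        have h1 : ¬ (j < PTree.leaf.leaves) := by simp only [PTree.leaves]; omega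
        simp only [PForest.side, h1, if_false]
        rfl
      · have h4 := PTree.leaves_of_del_some ha
        simp only [h0, if_true, ha, Option.some.injEq] at h
        subst h
        by_cases h1 : j < t.leaves
        · have h2 : j - 1 < a.leaves := by omega
          simp only [PForest.side, h1, h2, if_true]
          exact t.side_del_of_gt a _ i j hij h1 ha
        · have h2 : ¬ (j - 1 < a.leaves) := by omega
          have h3 : j - 1 - a.leaves = j - t.leaves := by omega
          simp only [PForest.side, h1, h2, h3, if_false]
    · obtain ⟨a, ha, h4⟩ := PForest.exists_del (f := f) (by omega) (i - t.leaves)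
      simp only [h0, if_false, ha, Option.some.injEq] at h
      subst h
      have h1 : ¬ (j < t.leaves) := by omega
      have h2 : ¬ (j - 1 < t.leaves) := by omega
      have h3 : j - 1 - t.leaves = j - t.leaves - 1 := by omega
      simp only [PForest.side, h1, h2, h3, if_false]
      exact f.side_del_of_gt a _ _ (by omega) (by omega) ha

end

theorem Compat.right_right (y : Side) : Compat .right y .right y := by cases y <;> trivial

theorem Compat.left_right (y : Side) : Compat .left y y .right := by cases y <;> trivial

mutual

theorem PTree.compat : (t a b : PTree) → (s : Side) → (i : ℕ) → i + 1 < t.leaves →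
    t.del i = some a → t.del (i + 1) = some b →
    Compat (t.side s i) (a.side s i) (b.side s i) (t.side s (i + 1))
  | .leaf, _, _, _, _, _, h, _ => by simp [PTree.del] at h
  | .node t f, a, b, s, i, hi, ha, hb => by
    simp only [PTree.leaves] at hi
    simp only [PTree.del] at ha hb
    by_cases h1 : i + 1 < t.leaves
    · have h0 : i < t.leaves := by omega
      obtain ⟨a', ha', ha''⟩ := PTree.exists_del (t := t) (by omega) i
      obtain ⟨b', hb', hb''⟩ := PTree.exists_del (t := t) (by omega) (i + 1)
      simp only [h0, if_true, ha', Option.some.injEq] at ha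
      simp only [h1, if_true, hb', Option.some.injEq] at hb
      subst ha hb
      have h2 : i < a'.leaves := by omega
      have h3 : i < b'.leaves := by omega
      simp only [PTree.side, h0, h1, h2, h3, if_true]
      exact t.compat a' b' _ i h1 ha' hb'
    · by_cases h0 : i < t.leaves
      · have h2 : i + 1 - t.leaves = 0 := by omega
        simp only [h1, if_false, h2] at hb
        simp only [h0, if_true] at ha
        cases t with
        | leaf =>
          simp only [PTree.leaves] at h0
          obtain rfl : i = 0 := by omega
          simp only [PTree.del, Option.some.injEq] at ha
          subst ha
          cases f with
          | one t' =>
            cases t' with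
            | leaf =>
              simp only [PForest.del, PTree.del, Option.some.injEq] at hb
              subst hb
              simpa [PTree.side, PForest.side, PForest.graft, PTree.leaves] using Compat.left_right s
            | node t'' f'' =>
              obtain ⟨b', hb', -⟩ := PForest.exists_del (f := .one (.node t'' f'')) (by
                have := t''.leaves_pos; have := f''.leaves_pos
                simp only [PTree.leaves, PForest.leaves]; omega) 0
              simp only [hb', Option.some.injEq] at hb
              subst hb
              simp [PForest.graft, PTree.side_node_zero, Compat]
          | cons t' f' =>
            obtain ⟨b', hb', -⟩ := PForest.exists_del (f := .cons t' f') (by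
                have := t'.leaves_pos; have := f'.leaves_pos
                simp only [PForest.leaves]; omega) 0
            simp only [hb', Option.some.injEq] at hb
            subst hb
            simp [PForest.graft, PTree.side_node_zero, Compat]
        | node t₁ f₁ =>
          have h5 := t₁.leaves_pos
          have h6 := f₁.leaves_pos
          obtain ⟨a', ha', ha''⟩ := PTree.exists_del (t := .node t₁ f₁) (by
            simp only [PTree.leaves]; omega) i
          simp only [ha', Option.some.injEq] at ha
          subst ha
          have h7 : ∀ s, (PTree.node t₁ f₁).side s i = .right := fun s =>
            PTree.side_node_last _ _ _ _ (by omega)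
          have h8 : b.side s i = .right := by
            rcases hf : f.del 0 with _ | f'
            · simp only [hf, Option.some.injEq] at hb
              subst hb; exact h7 s
            · simp only [hf, Option.some.injEq] at hb
              subst hb
              rw [PTree.side, if_pos h0]; exact h7 _
          have h9 : ¬ (i < a'.leaves) := by omega
          have h10 : i - a'.leaves = 0 := by omega
          rw [h8, PTree.side, if_pos h0, h7, PTree.side, if_neg h9, h10, PTree.side, if_neg h1, h2]
          exact Compat.right_right _
      · have h2 : i + 1 - t.leaves = i - t.leaves + 1 := by omega
        obtain ⟨a', ha', ha''⟩ := PForest.exists_del (f := f) (by omega) (i - t.leaves)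
        obtain ⟨b', hb', hb''⟩ := PForest.exists_del (f := f) (by omega) (i - t.leaves + 1)
        simp only [h0, if_false, ha', Option.some.injEq] at ha
        simp only [h1, if_false, h2, hb', Option.some.injEq] at hb
        subst ha hb
        simp only [PTree.side, h0, h1, h2, if_false]
        exact f.compat a' b' _ (by omega) ha' hb'

theorem PForest.compat : (f a b : PForest) → (i : ℕ) → i + 1 < f.leaves →
    f.del i = some a → f.del (i + 1) = some b →
    Compat (f.side i) (a.side i) (b.side i) (f.side (i + 1))
  | .one t, a, b, i, hi, ha, hb => by
    simp only [PForest.leaves] at hi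
    simp only [PForest.del] at ha hb
    obtain ⟨a', ha', ha''⟩ := PTree.exists_del (t := t) (by omega) i
    obtain ⟨b', hb', hb''⟩ := PTree.exists_del (t := t) (by omega) (i + 1)
    simp only [ha', Option.some.injEq] at ha
    simp only [hb', Option.some.injEq] at hb
    subst ha hb
    simp only [PForest.side]
    exact t.compat a' b' _ i hi ha' hb'
  | .cons t f, a, b, i, hi, ha, hb => by
    simp only [PForest.leaves] at hi
    simp only [PForest.del] at ha hb
    by_cases h1 : i + 1 < t.leaves
    · have h0 : i < t.leaves := by omega
      obtain ⟨a', ha', ha''⟩ := PTree.exists_del (t := t) (by omega) i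
      obtain ⟨b', hb', hb''⟩ := PTree.exists_del (t := t) (by omega) (i + 1)
      simp only [h0, if_true, ha', Option.some.injEq] at ha
      simp only [h1, if_true, hb', Option.some.injEq] at hb
      subst ha hb
      have h2 : i < a'.leaves := by omega
      have h3 : i < b'.leaves := by omega
      simp only [PForest.side, h0, h1, h2, h3, if_true]
      exact t.compat a' b' _ i h1 ha' hb'
    · by_cases h0 : i < t.leaves
      · have h2 : i + 1 - t.leaves = 0 := by omega
        simp only [h1, if_false, h2] at hb
        simp only [h0, if_true] at ha
        cases t with
        | leaf =>
          simp only [PTree.leaves] at h0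
          obtain rfl : i = 0 := by omega
          simp only [PTree.del, Option.some.injEq] at ha
          subst ha
          cases f with
          | one t' =>
            cases t' with
            | leaf =>
              simp only [PForest.del, PTree.del, Option.some.injEq] at hb
              subst hb
              simp [PTree.side, PForest.side, PTree.leaves, Compat]
            | node t'' f'' =>
              obtain ⟨b', hb', -⟩ := PForest.exists_del (f := .one (.node t'' f'')) (by
                have := t''.leaves_pos; have := f''.leaves_pos
                simp only [PTree.leaves, PForest.leaves]; omega) 0
              simp only [hb', Option.some.injEq] at hb
              subst hb
              simp [PTree.side, PForest.side, PTree.leaves, Compat, t''.leaves_pos,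
                PTree.side_left_zero]
          | cons t' f' =>
            obtain ⟨b', hb', -⟩ := PForest.exists_del (f := .cons t' f') (by
                have := t'.leaves_pos; have := f'.leaves_pos
                simp only [PForest.leaves]; omega) 0
            simp only [hb', Option.some.injEq] at hb
            subst hb
            cases t' with
            | leaf => simp [PTree.side, PForest.side, PTree.leaves, Compat]
            | node t'' f'' =>
              simp [PTree.side, PForest.side, PTree.leaves, Compat, t''.leaves_pos,
                PTree.side_left_zero]
        | node t₁ f₁ =>
          have h5 := t₁.leaves_pos
          have h6 := f₁.leaves_pos
          obtain ⟨a', ha', ha''⟩ := PTree.exists_del (t := .node t₁ f₁) (by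
            simp only [PTree.leaves]; omega) i
          simp only [ha', Option.some.injEq] at ha
          subst ha
          have h7 : ∀ s, (PTree.node t₁ f₁).side s i = .right := fun s =>
            PTree.side_node_last _ _ _ _ (by omega)
          have h8 : b.side i = .right := by
            rcases hf : f.del 0 with _ | f'
            · simp only [hf, Option.some.injEq] at hb
              subst hb; exact h7 _
            · simp only [hf, Option.some.injEq] at hb
              subst hb
              rw [PForest.side, if_pos h0]; exact h7 _
          have h9 : ¬ (i < a'.leaves) := by omega
          have h10 : i - a'.leaves = 0 := by omega
          rw [h8, PForest.side, if_pos h0, h7, PForest.side, if_neg h9, h10, PForest.side,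
            if_neg h1, h2]
          exact Compat.right_right _
      · have h2 : i + 1 - t.leaves = i - t.leaves + 1 := by omega
        obtain ⟨a', ha', ha''⟩ := PForest.exists_del (f := f) (by omega) (i - t.leaves)
        obtain ⟨b', hb', hb''⟩ := PForest.exists_del (f := f) (by omega) (i - t.leaves + 1)
        simp only [h0, if_false, ha', Option.some.injEq] at ha
        simp only [h1, if_false, h2, hb', Option.some.injEq] at hb
        subst ha hb
        simp only [PForest.side, h0, h1, h2, if_false]
        exact f.compat a' b' _ (by omega) ha' hb'

end


/-- The set `Tₙ` of planar trees with `n + 1` leaves. -/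
def T (n : ℕ) : Type := {t : PTree // t.leaves = n + 1}

theorem T.del_isSome {n : ℕ} (t : T (n + 1)) (i : ℕ) : (t.1.del i).isSome := by
  obtain ⟨t', h, -⟩ := PTree.exists_del (t := t.1) (by rw [t.2]; omega) i
  simp [h]

theorem T.leaves_get {n : ℕ} (t : T (n + 1)) (i : ℕ) :
    ((t.1.del i).get (t.del_isSome i)).leaves = n + 1 := by
  have h := PTree.leaves_of_del_some (Option.some_get (t.del_isSome i)).symm
  have := t.2
  omega

/-- The tree obtained by deleting the `i`-th leaf (leaves numbered `0, …, n + 1`). -/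
def T.face {n : ℕ} (i : ℕ) (t : T (n + 1)) : T n :=
  ⟨(t.1.del i).get (t.del_isSome i), t.leaves_get i⟩

/-- The position of the `i`-th leaf (leaves numbered `0, …, n`) of a tree with at least two leaves. -/
def T.side {n : ℕ} (t : T n) (i : ℕ) : Side := t.1.side .middle i

theorem T.del_eq {n : ℕ} (t : T (n + 1)) (i : ℕ) : t.1.del i = some (t.face i).1 :=
  (Option.some_get (t.del_isSome i)).symm

theorem T.face_face {n : ℕ} (t : T (n + 2)) (i j : ℕ) (hij : i < j) (hj : j < n + 3) :
    (t.face j).face i = (t.face i).face (j - 1) := by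
  have h := t.1.del_del i j hij (by rw [t.2]; omega)
  simp only [T.del_eq, Option.bind_some, Option.some.injEq] at h
  exact Subtype.ext h

theorem T.side_face_of_lt {n : ℕ} (t : T (n + 1)) (i j : ℕ) (hij : i + 1 < j) (hj : j < n + 2) :
    (t.face j).side i = t.side i :=
  t.1.side_del_of_lt _ _ i j hij (by rw [t.2]; omega) (t.del_eq j)

theorem T.side_face_of_gt {n : ℕ} (t : T (n + 1)) (i j : ℕ) (hij : i + 1 < j) (hj : j < n + 2) :
    (t.face i).side (j - 1) = t.side j :=
  t.1.side_del_of_gt _ _ i j hij (by rw [t.2]; omega) (t.del_eq i)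

theorem T.compat {n : ℕ} (t : T (n + 1)) (i : ℕ) (hi : i + 1 < n + 2) :
    Compat (t.side i) ((t.face i).side i) ((t.face (i + 1)).side i) (t.side (i + 1)) :=
  t.1.compat _ _ _ i (by rw [t.2]; omega) (t.del_eq i) (t.del_eq (i + 1))

/-- The unique planar tree with two leaves. -/
def Y : T 1 := ⟨.node .leaf (.one .leaf), rfl⟩

/-- Associative trialgebras: vector spaces with three bilinear operations `left` (⊣),
`right` (⊢) and `mid` (⊥) satisfying eleven relations. -/
class Trialgebra (K : Type u) (A : Type w) [Field K] [AddCommGroup A] [Module K A] where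
  left : A →ₗ[K] A →ₗ[K] A
  right : A →ₗ[K] A →ₗ[K] A
  mid : A →ₗ[K] A →ₗ[K] A
  -- (x ⊣ y) ⊣ z = x ⊣ (y ⊣ z)
  left_left : ∀ x y z : A, left (left x y) z = left x (left y z)
  -- (x ⊣ y) ⊣ z = x ⊣ (y ⊢ z)
  left_left_right : ∀ x y z : A, left (left x y) z = left x (right y z)
  -- (x ⊢ y) ⊣ z = x ⊢ (y ⊣ z)
  right_left : ∀ x y z : A, left (right x y) z = right x (left y z)
  -- (x ⊣ y) ⊢ z = x ⊢ (y ⊢ z)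
  left_right : ∀ x y z : A, right (left x y) z = right x (right y z)
  -- (x ⊢ y) ⊢ z = x ⊢ (y ⊢ z)
  right_right : ∀ x y z : A, right (right x y) z = right x (right y z)
  -- (x ⊣ y) ⊣ z = x ⊣ (y ⊥ z)
  left_left_mid : ∀ x y z : A, left (left x y) z = left x (mid y z)
  -- (x ⊥ y) ⊣ z = x ⊥ (y ⊣ z)
  mid_left : ∀ x y z : A, left (mid x y) z = mid x (left y z)
  -- (x ⊣ y) ⊥ z = x ⊥ (y ⊢ z)
  left_mid : ∀ x y z : A, mid (left x y) z = mid x (right y z)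
  -- (x ⊢ y) ⊥ z = x ⊢ (y ⊥ z)
  right_mid : ∀ x y z : A, mid (right x y) z = right x (mid y z)
  -- (x ⊥ y) ⊢ z = x ⊢ (y ⊢ z)
  mid_right : ∀ x y z : A, right (mid x y) z = right x (right y z)
  -- (x ⊥ y) ⊥ z = x ⊥ (y ⊥ z)
  mid_mid : ∀ x y z : A, mid (mid x y) z = mid x (mid y z)

section

variable (K : Type u) {A : Type w} [Field K] [AddCommGroup A] [Module K A] [Trialgebra K A]

/-- The operation attached to the position of a leaf: left leaf ↦ ⊣, middle leaf ↦ ⊥, right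
leaf ↦ ⊢. -/
def op : Side → (A →ₗ[K] A →ₗ[K] A)
  | .left => Trialgebra.left
  | .middle => Trialgebra.mid
  | .right => Trialgebra.right

variable {K}

theorem Compat.assoc {p q r s : Side} (h : Compat p q r s) (x y z : A) :
    op K q (op K p x y) z = op K r x (op K s y z) := by
  cases p <;> cases q <;> cases r <;> cases s <;> first | exact h.elim | skip
  all_goals first
    | exact Trialgebra.left_left x y z
    | exact Trialgebra.left_left_right x y z
    | exact Trialgebra.right_left x y z
    | exact Trialgebra.left_right x y z
    | exact Trialgebra.right_right x y z
    | exact Trialgebra.left_left_mid x y z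
    | exact Trialgebra.mid_left x y z
    | exact Trialgebra.left_mid x y z
    | exact Trialgebra.right_mid x y z
    | exact Trialgebra.mid_right x y z
    | exact Trialgebra.mid_mid x y z

end

/-- Morphisms of associative trialgebras: linear maps compatible with the three operations. -/
structure IsHom {K : Type u} {A : Type v} {B : Type w} [Field K] [AddCommGroup A] [Module K A]
    [Trialgebra K A] [AddCommGroup B] [Module K B] [Trialgebra K B] (g : A →ₗ[K] B) : Prop where
  map_left : ∀ x y, g (Trialgebra.left (K := K) x y) = Trialgebra.left (K := K) (g x) (g y)
  map_right : ∀ x y, g (Trialgebra.right (K := K) x y) = Trialgebra.right (K := K) (g x) (g y)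
  map_mid : ∀ x y, g (Trialgebra.mid (K := K) x y) = Trialgebra.mid (K := K) (g x) (g y)

/-- The trialgebra `A` together with the linear map `ι : V → A` is the free associative trialgebra
on `V`: each linear map from `V` to a trialgebra `B` extends uniquely along `ι` to a morphism of
trialgebras. (`B` ranges over a universe that contains copies of `K`, `V` and `A`.) -/
def IsFree {K : Type u} {V : Type v} {A : Type w} [Field K] [AddCommGroup V] [Module K V]
    [AddCommGroup A] [Module K A] [Trialgebra K A] (ι : V →ₗ[K] A) : Prop :=
  ∀ (B : Type (max u v w)) [AddCommGroup B] [Module K B] [Trialgebra K B] (f : V →ₗ[K] B),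
    ∃! g : A →ₗ[K] B, IsHom g ∧ g ∘ₗ ι = f

section Complex

variable (K : Type u) (A : Type w) [Field K] [AddCommGroup A] [Module K A]

variable {K A} in
theorem contractNth_update {n : ℕ} [DecidableEq (Fin (n + 1))] (m : A →ₗ[K] A →ₗ[K] A) (i : Fin n)
    (a : Fin (n + 1) → A) (k : Fin (n + 1)) :
    ∃ (j : Fin n) (L : A →ₗ[K] A), ∀ x,
      Fin.contractNth i.castSucc (fun x y => m x y) (Function.update a k x) =
        Function.update (Fin.contractNth i.castSucc (fun x y => m x y) a) j (L x) := by
  rcases lt_trichotomy (k : ℕ) (i : ℕ) with h | h | h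
  · refine ⟨⟨k, by omega⟩, .id, fun x => ?_⟩
    ext j
    simp only [Fin.contractNth, Function.update_apply, Fin.ext_iff, Fin.val_castSucc, Fin.val_succ,
      LinearMap.id_apply]
    split_ifs <;> first | rfl | omega
  · refine ⟨⟨k, by omega⟩, m.flip (a i.succ), fun x => ?_⟩
    ext j
    simp only [Fin.contractNth, Function.update_apply, Fin.ext_iff, Fin.val_castSucc, Fin.val_succ,
      LinearMap.flip_apply]
    split_ifs <;> first | rfl | omega | skip
    congr 2; ext; simp; omega
  · by_cases h' : (k : ℕ) = i + 1
    · refine ⟨⟨i, by omega⟩, m (a i.castSucc), fun x => ?_⟩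
      ext j
      simp only [Fin.contractNth, Function.update_apply, Fin.ext_iff, Fin.val_castSucc,
        Fin.val_succ]
      split_ifs <;> first | rfl | omega | skip
      congr 2; congr 1; ext; simp; omega
    · refine ⟨⟨k - 1, by omega⟩, .id, fun x => ?_⟩
      ext j
      simp only [Fin.contractNth, Function.update_apply, Fin.ext_iff, Fin.val_castSucc,
        Fin.val_succ, LinearMap.id_apply]
      split_ifs <;> first | rfl | omega

variable {K A} in
/-- The linear map `a₀ ⊗ ⋯ ⊗ aₙ ↦ a₀ ⊗ ⋯ ⊗ m aᵢ aᵢ₊₁ ⊗ ⋯ ⊗ aₙ`. -/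
noncomputable def mulAt {n : ℕ} (m : A →ₗ[K] A →ₗ[K] A) (i : Fin n) : ⨂[K]^(n + 1) A →ₗ[K] ⨂[K]^n A :=
  PiTensorProduct.lift
    { toFun := fun a => PiTensorProduct.tprod K (Fin.contractNth i.castSucc (fun x y => m x y) a)
      map_update_add' := fun a k x y => by
        obtain ⟨j, L, h⟩ := contractNth_update m i a k
        simp only [h, map_add, MultilinearMap.map_update_add]
      map_update_smul' := fun a k c x => by
        obtain ⟨j, L, h⟩ := contractNth_update m i a k
        simp only [h, map_smul, MultilinearMap.map_update_smul] }

variable {K A} in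
theorem mulAt_tprod {n : ℕ} (m : A →ₗ[K] A →ₗ[K] A) (i : Fin n) (a : Fin (n + 1) → A) :
    mulAt m i (PiTensorProduct.tprod K a) =
      PiTensorProduct.tprod K (Fin.contractNth i.castSucc (fun x y => m x y) a) :=
  PiTensorProduct.lift.tprod _

/-- The vector space `K[Tₙ] ⊗ A^{⊗n}`. -/
abbrev Chains (n : ℕ) : Type (max u w) := (T n →₀ K) ⊗[K] (⨂[K]^n A)

variable [Trialgebra K A]

/-- For `i = 0, …, n - 1` (so that `i + 1` runs through the interior leaves `1, …, n` of a tree `t`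
in `Tₙ₊₁`), the linear map `dᵢ₊₁` sending `(t; a₁, …, aₙ₊₁)` to `(t'; a₁, …, aᵢ₊₁ ∘ aᵢ₊₂, …, aₙ₊₁)`,
where `t'` is `t` with the leaf number `i + 1` deleted, and `∘` is the operation attached to the
position of this leaf in `t`. -/
noncomputable def face {n : ℕ} (i : Fin n) : Chains K A (n + 1) →ₗ[K] Chains K A n :=
  TensorProduct.lift (Finsupp.linearCombination K fun t : T (n + 1) =>
    TensorProduct.mk K (T n →₀ K) (⨂[K]^n A) (Finsupp.single (t.face (i + 1)) 1) ∘ₗ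
      mulAt (op K (t.side (i + 1))) i)

/-- The boundary map `d = ∑ (-1)^i dᵢ`, the sum over `i = 1, …, n`, on `K[Tₙ₊₁] ⊗ A^{⊗(n+1)}`. -/
noncomputable def boundary (n : ℕ) : Chains K A (n + 1) →ₗ[K] Chains K A n :=
  ∑ i : Fin n, (-1 : K) ^ ((i : ℕ) + 1) • face K A i

variable {K A} in
theorem face_basis {n : ℕ} (i : Fin n) (t : T (n + 1)) (a : Fin (n + 1) → A) :
    face K A i (Finsupp.single t 1 ⊗ₜ PiTensorProduct.tprod K a) =
      Finsupp.single (t.face (i + 1)) 1 ⊗ₜ PiTensorProduct.tprod K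
        (Fin.contractNth i.castSucc (fun x y => op K (t.side (i + 1)) x y) a) := by
  simp [face, mulAt_tprod]

theorem contractNth_contractNth {α : Type w} {n : ℕ} (p q r s : α → α → α) (i : Fin n)
    (j : Fin (n + 1)) (h : i.castSucc < j)
    (h₁ : (i : ℕ) + 1 = j → ∀ x y z, q (p x y) z = r x (s y z))
    (h₂ : (i : ℕ) + 1 < j → r = p ∧ q = s) (a : Fin (n + 2) → α) :
    Fin.contractNth i.castSucc r (Fin.contractNth j.castSucc s a) =
      Fin.contractNth (j.pred (Fin.ne_zero_of_lt h)).castSucc q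
        (Fin.contractNth i.castSucc.castSucc p a) := by
  have hij : (i : ℕ) < j := h
  obtain ⟨b, hb⟩ : ∃ b : ℕ → α, a = fun k : Fin (n + 2) => b (k : ℕ) :=
    ⟨fun m => if hm : m < n + 2 then a ⟨m, hm⟩ else a 0, by ext k; simp⟩
  subst hb
  ext k
  simp only [Fin.contractNth, Fin.val_castSucc, Fin.val_succ, Fin.val_pred]
  rcases Nat.lt_or_ge ((i : ℕ) + 1) j with h3 | h3
  · obtain ⟨rfl, rfl⟩ := h₂ h3
    split_ifs <;> first | rfl | omega
  · have h4 : (i : ℕ) + 1 = j := by omega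
    have h5 := h₁ h4
    split_ifs <;> first | rfl | omega | skip
    all_goals simp [h5]

theorem face_face {n : ℕ} (i : Fin n) (j : Fin (n + 1)) (h : i.castSucc < j) :
    face K A i ∘ₗ face K A j =
      face K A (j.pred (Fin.ne_zero_of_lt h)) ∘ₗ face K A i.castSucc := by
  have hij : (i : ℕ) < j := h
  have hj := j.2
  ext t a
  simp only [LinearMap.compMultilinearMap_apply, TensorProduct.AlgebraTensorModule.curry_apply,
    LinearMap.restrictScalars_self, TensorProduct.curry_apply, LinearMap.coe_comp,
    Function.comp_apply, Finsupp.lsingle_apply, face_basis]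
  have h1 : ((j.pred (Fin.ne_zero_of_lt h) : Fin n) : ℕ) + 1 = j := by
    rw [Fin.val_pred]; omega
  rw [h1, Fin.val_castSucc, T.face_face t (i + 1) (j + 1) (by omega) (by omega),
    Nat.add_sub_cancel]
  congr 2
  apply contractNth_contractNth _ _ _ _ i j h
  · intro h2 x y z
    rw [← h2]
    exact (t.compat (i + 1) (by omega)).assoc x y z
  · intro h2
    rw [T.side_face_of_lt t (i + 1) (j + 1) (by omega) (by omega)]
    have := T.side_face_of_gt t (i + 1) (j + 1) (by omega) (by omega)
    rw [Nat.add_sub_cancel] at this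
    rw [this]
    exact ⟨rfl, rfl⟩

theorem boundary_boundary (n : ℕ) : boundary K A n ∘ₗ boundary K A (n + 1) = 0 := by
  have hexp : boundary K A n ∘ₗ boundary K A (n + 1) = ∑ x : Fin n × Fin (n + 1),
      (-1 : K) ^ ((x.1 : ℕ) + x.2) • (face K A x.1 ∘ₗ face K A x.2) := by
    refine LinearMap.ext fun x => ?_
    rw [Fintype.sum_prod_type]
    simp only [boundary, LinearMap.sum_apply, LinearMap.smul_apply, LinearMap.comp_apply, map_sum,
      map_smul, Finset.smul_sum, smul_smul]
    rw [Finset.sum_comm]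
    refine Finset.sum_congr rfl fun i _ => Finset.sum_congr rfl fun j _ => ?_
    congr 1
    ring
  rw [hexp]
  refine Finset.sum_involution (fun x _ =>
      if h : x.1.castSucc < x.2 then (x.2.pred (Fin.ne_zero_of_lt h), x.1.castSucc)
      else (x.2.castLT (by
        have := x.1.2
        rw [Fin.lt_def, Fin.val_castSucc] at h
        omega), x.1.succ)) ?_ ?_ ?_ ?_
  · rintro ⟨i, j⟩ -
    by_cases h : i.castSucc < j
    · have hij : (i : ℕ) < j := h
      simp only [h, dif_pos]
      rw [face_face K A i j h, ← add_smul]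
      obtain ⟨m, hm⟩ : ∃ m, (j : ℕ) = m + 1 := ⟨j - 1, by omega⟩
      rw [Fin.val_pred, Fin.val_castSucc, hm]
      convert zero_smul K _ using 2
      simp only [Nat.add_sub_cancel]
      ring
    · have hij : (j : ℕ) ≤ i := by
        rw [Fin.lt_def, Fin.val_castSucc] at h; omega
      simp only [h, dif_neg, not_false_eq_true]
      have h' : (j.castLT (by omega) : Fin n).castSucc < i.succ := by
        rw [Fin.lt_def]; simp; omega
      rw [face_face K A _ i.succ h']
      simp only [Fin.pred_succ, Fin.castSucc_castLT, Fin.val_castLT, Fin.val_succ]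
      rw [← add_smul]
      convert zero_smul K _ using 2
      ring
  · rintro ⟨i, j⟩ - - h
    simp only at h
    split_ifs at h with h'
    · have := congrArg (fun x => (x.2 : ℕ)) h
      have h'' : (i : ℕ) < j := h'
      simp at this
      omega
    · rw [Fin.lt_def, Fin.val_castSucc] at h'
      have := congrArg (fun x => (x.2 : ℕ)) h
      simp at this
      omega
  · intro x _
    exact Finset.mem_univ _
  · rintro ⟨i, j⟩ -
    by_cases h : i.castSucc < j
    · have hij : (i : ℕ) < j := h
      have h' : ¬ ((j.pred (Fin.ne_zero_of_lt h)).castSucc < i.castSucc) := by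
        rw [Fin.lt_def]; simp; omega
      simp only [h, dif_pos, h', dif_neg, not_false_eq_true, Fin.succ_pred, Fin.castLT_castSucc]
    · have hij : (j : ℕ) ≤ i := by
        rw [Fin.lt_def, Fin.val_castSucc] at h; omega
      have h' : j < i.succ := by
        rw [Fin.lt_def]; simp; omega
      simp only [h, h', dif_pos, dif_neg, not_false_eq_true, Fin.pred_succ, Fin.castSucc_castLT]

open CategoryTheory

/-- The term of degree `n` of the chain complex of a trialgebra: `K[Tₙ] ⊗ A^{⊗n}` for `n ≥ 1`,
and zero for `n = 0`. -/
noncomputable def chainModule : ℕ → ModuleCat.{max u w} K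
  | 0 => ModuleCat.of K PUnit
  | n + 1 => ModuleCat.of K (Chains K A (n + 1))

/-- The differentials of the chain complex of a trialgebra. -/
noncomputable def chainMap : (n : ℕ) → (chainModule K A (n + 1) ⟶ chainModule K A n)
  | 0 => 0
  | n + 1 => ModuleCat.ofHom (boundary K A (n + 1))

theorem chainMap_comp : (n : ℕ) → chainMap K A (n + 1) ≫ chainMap K A n = 0
  | 0 => Limits.comp_zero
  | n + 1 => ModuleCat.hom_ext (boundary_boundary K A (n + 1))

/-- The chain complex of a trialgebra `A`, with `K[Tₙ] ⊗ A^{⊗n}` in degree `n ≥ 1`. -/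
noncomputable def chainComplex : ChainComplex (ModuleCat.{max u w} K) ℕ :=
  ChainComplex.of (chainModule K A) (chainMap K A) (chainMap_comp K A)

theorem chainComplex_d_one_zero : (chainComplex K A).d 1 0 = 0 :=
  ChainComplex.of_d (chainModule K A) (chainMap K A) 0

/-- All chains of degree `1` are cycles, and this is the map sending a chain of degree `1` to its
homology class. -/
noncomputable def homologyClassOne : Chains K A 1 →ₗ[K] (chainComplex K A).homology 1 :=
  ((chainComplex K A).liftCycles (𝟙 ((chainComplex K A).X 1)) 0 (by simp)
    (by rw [chainComplex_d_one_zero]; exact Limits.comp_zero) ≫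
      (chainComplex K A).homologyπ 1).hom

end Complex

/-! Existence of the free trialgebra, by generators and relations. -/

section Existence

variable (K : Type u) (V : Type v) [Field K] [AddCommGroup V] [Module K V]

/-- Formal products of elements of `V` for three binary operations. -/
inductive Word (V : Type v) : Type v where
  | of : V → Word V
  | mul : Side → Word V → Word V → Word V

abbrev FreeMagma3 : Type (max u v) := Word V →₀ K

noncomputable def magmaMul (s : Side) : FreeMagma3 K V →ₗ[K] FreeMagma3 K V →ₗ[K] FreeMagma3 K V :=
  Finsupp.linearCombination K fun a => Finsupp.lmapDomain K K fun b => Word.mul s a b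

/-- The ideals modulo which formal products form a trialgebra with a linear map from `V`. -/
structure IsRelationIdeal (N : Submodule K (FreeMagma3 K V)) : Prop where
  add_mem : ∀ v w : V, Finsupp.single (Word.of (v + w)) 1 - Finsupp.single (Word.of v) 1
    - Finsupp.single (Word.of w) 1 ∈ N
  smul_mem : ∀ (c : K) (v : V), Finsupp.single (Word.of (c • v)) 1
    - c • Finsupp.single (Word.of v) (1 : K) ∈ N
  mul_mem_left : ∀ s x y, x ∈ N → magmaMul K V s x y ∈ N
  mul_mem_right : ∀ s x y, y ∈ N → magmaMul K V s x y ∈ N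
  assoc : ∀ p q r s, Compat p q r s → ∀ x y z, magmaMul K V q (magmaMul K V p x y) z
    - magmaMul K V r x (magmaMul K V s y z) ∈ N

/-- The smallest ideal of relations. -/
noncomputable def relations : Submodule K (FreeMagma3 K V) := sInf {N | IsRelationIdeal K V N}

theorem relations_isRelationIdeal : IsRelationIdeal K V (relations K V) where
  add_mem v w := by
    simp only [relations, Submodule.mem_sInf]; intro N hN; exact hN.add_mem v w
  smul_mem c v := by
    simp only [relations, Submodule.mem_sInf]; intro N hN; exact hN.smul_mem c v
  mul_mem_left s x y h := by
    simp only [relations, Submodule.mem_sInf] at h ⊢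
    intro N hN; exact hN.mul_mem_left s x y (h N hN)
  mul_mem_right s x y h := by
    simp only [relations, Submodule.mem_sInf] at h ⊢
    intro N hN; exact hN.mul_mem_right s x y (h N hN)
  assoc p q r s h x y z := by
    simp only [relations, Submodule.mem_sInf]; intro N hN; exact hN.assoc p q r s h x y z

/-- The free associative trialgebra on `V`, as a quotient of the space of linear combinations of
formal products. -/
def FreeTrialgebra : Type (max u v) := FreeMagma3 K V ⧸ relations K V

noncomputable instance : AddCommGroup (FreeTrialgebra K V) :=
  inferInstanceAs (AddCommGroup (FreeMagma3 K V ⧸ relations K V))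

noncomputable instance : Module K (FreeTrialgebra K V) :=
  inferInstanceAs (Module K (FreeMagma3 K V ⧸ relations K V))

namespace FreeTrialgebra

noncomputable def mk : FreeMagma3 K V →ₗ[K] FreeTrialgebra K V := (relations K V).mkQ

theorem mk_surjective : Function.Surjective (mk K V) := (relations K V).mkQ_surjective

theorem mk_eq_zero {x : FreeMagma3 K V} : mk K V x = 0 ↔ x ∈ relations K V :=
  Submodule.Quotient.mk_eq_zero _

noncomputable def desc {B : Type*} [AddCommGroup B] [Module K B] (f : FreeMagma3 K V →ₗ[K] B)
    (h : ∀ x ∈ relations K V, f x = 0) : FreeTrialgebra K V →ₗ[K] B :=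
  (relations K V).liftQ f h

@[simp] theorem desc_mk {B : Type*} [AddCommGroup B] [Module K B] (f : FreeMagma3 K V →ₗ[K] B)
    (h : ∀ x ∈ relations K V, f x = 0) (x) : desc K V f h (mk K V x) = f x :=
  (relations K V).liftQ_apply f x

noncomputable def mul (s : Side) :
    FreeTrialgebra K V →ₗ[K] FreeTrialgebra K V →ₗ[K] FreeTrialgebra K V :=
  desc K V (LinearMap.flip (desc K V ((magmaMul K V s).compr₂ (mk K V)).flip fun y hy => by
    ext x
    exact (mk_eq_zero K V).2 ((relations_isRelationIdeal K V).mul_mem_right s _ y hy)))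
    fun x hx => by
      ext y
      obtain ⟨y, rfl⟩ := mk_surjective K V y
      simpa using (mk_eq_zero K V).2 ((relations_isRelationIdeal K V).mul_mem_left s x y hx)

theorem mul_mk (s : Side) (x y : FreeMagma3 K V) :
    mul K V s (mk K V x) (mk K V y) = mk K V (magmaMul K V s x y) := by
  simp [mul]

theorem mul_assoc' {p q r s : Side} (h : Compat p q r s) (x y z : FreeTrialgebra K V) :
    mul K V q (mul K V p x y) z = mul K V r x (mul K V s y z) := by
  obtain ⟨x, rfl⟩ := mk_surjective K V x
  obtain ⟨y, rfl⟩ := mk_surjective K V y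
  obtain ⟨z, rfl⟩ := mk_surjective K V z
  simp only [mul_mk]
  rw [← sub_eq_zero, ← map_sub]
  exact (mk_eq_zero K V).2 ((relations_isRelationIdeal K V).assoc p q r s h x y z)

noncomputable instance : Trialgebra K (FreeTrialgebra K V) where
  left := mul K V .left
  right := mul K V .right
  mid := mul K V .middle
  left_left := mul_assoc' K V trivial
  left_left_right := mul_assoc' K V trivial
  right_left := mul_assoc' K V trivial
  left_right := mul_assoc' K V trivial
  right_right := mul_assoc' K V trivial
  left_left_mid := mul_assoc' K V trivial
  mid_left := mul_assoc' K V trivial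
  left_mid := mul_assoc' K V trivial
  right_mid := mul_assoc' K V trivial
  mid_right := mul_assoc' K V trivial
  mid_mid := mul_assoc' K V trivial

noncomputable def ι : V →ₗ[K] FreeTrialgebra K V where
  toFun v := mk K V (Finsupp.single (Word.of v) 1)
  map_add' v w := by
    rw [← sub_eq_zero, ← sub_sub, ← map_sub, ← map_sub]
    exact (mk_eq_zero K V).2 ((relations_isRelationIdeal K V).add_mem v w)
  map_smul' c v := by
    rw [RingHom.id_apply, ← sub_eq_zero, ← map_smul, ← map_sub]
    exact (mk_eq_zero K V).2 ((relations_isRelationIdeal K V).smul_mem c v)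

theorem op_eq (s : Side) : op K (A := FreeTrialgebra K V) s = mul K V s := by cases s <;> rfl

variable {K V}

def evalWord {B : Type*} [AddCommGroup B] [Module K B] [Trialgebra K B] (f : V →ₗ[K] B) :
    Word V → B
  | .of v => f v
  | .mul s a b => op K s (evalWord f a) (evalWord f b)

theorem eval_mul {B : Type*} [AddCommGroup B] [Module K B] [Trialgebra K B] (f : V →ₗ[K] B)
    (s : Side) (x y : FreeMagma3 K V) :
    Finsupp.linearCombination K (evalWord f) (magmaMul K V s x y) =
      op K s (Finsupp.linearCombination K (evalWord f) x)
        (Finsupp.linearCombination K (evalWord f) y) := by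
  have : (magmaMul K V s).compr₂ (Finsupp.linearCombination K (evalWord f)) =
      (op K s).compl₁₂ (Finsupp.linearCombination K (evalWord f))
        (Finsupp.linearCombination K (evalWord f)) := by
    ext a b
    simp [magmaMul, evalWord]
  exact LinearMap.congr_fun₂ this x y

theorem isFree : IsFree (ι K V) := by
  intro B _ _ _ f
  let F := Finsupp.linearCombination K (evalWord f)
  have hF : ∀ x ∈ relations K V, F x = 0 := by
    suffices hle : relations K V ≤ LinearMap.ker F from fun x hx => hle hx
    refine sInf_le ⟨?_, ?_, ?_, ?_, ?_⟩
    · intro v w; simp [F, evalWord]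
    · intro c v; simp [F, evalWord]
    · intro s x y h
      rw [LinearMap.mem_ker] at h ⊢
      simp only [F, eval_mul] at h ⊢
      rw [h]; simp
    · intro s x y h
      rw [LinearMap.mem_ker] at h ⊢
      simp only [F, eval_mul] at h ⊢
      rw [h]; simp
    · intro p q r s h x y z
      rw [LinearMap.mem_ker, map_sub, sub_eq_zero]
      simp only [F, eval_mul]
      exact h.assoc _ _ _
  have hmul : ∀ s x y, desc K V F hF (mul K V s x y) =
      op K s (desc K V F hF x) (desc K V F hF y) := by
    intro s x y
    obtain ⟨x, rfl⟩ := mk_surjective K V x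
    obtain ⟨y, rfl⟩ := mk_surjective K V y
    rw [mul_mk, desc_mk, desc_mk, desc_mk]
    exact eval_mul f s x y
  refine ⟨desc K V F hF, ⟨⟨hmul .left, hmul .right, hmul .middle⟩, ?_⟩, ?_⟩
  · ext v
    change desc K V F hF (mk K V _) = _
    rw [desc_mk]
    simp [F, evalWord]
  · rintro g ⟨⟨h1, h2, h3⟩, hg⟩
    have hop : ∀ s x y, g (mul K V s x y) = op K s (g x) (g y) := by
      intro s; cases s
      exacts [h1, h3, h2]
    have key : g ∘ₗ mk K V = F := by
      refine Finsupp.lhom_ext' fun a => LinearMap.ext_ring ?_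
      change g (mk K V (Finsupp.single a 1)) = F (Finsupp.single a 1)
      have hFa : F (Finsupp.single a 1) = evalWord f a := by simp [F]
      rw [hFa]
      induction a with
      | of v => exact LinearMap.congr_fun hg v
      | mul s a b iha ihb =>
        have : (Finsupp.single (Word.mul s a b) 1 : FreeMagma3 K V) =
            magmaMul K V s (Finsupp.single a 1) (Finsupp.single b 1) := by
          simp [magmaMul]
        rw [this, ← mul_mk, hop, iha (by simp [F]), ihb (by simp [F]), evalWord]
    ext x
    obtain ⟨x, rfl⟩ := mk_surjective K V x
    rw [desc_mk]
    exact LinearMap.congr_fun key x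

end FreeTrialgebra

end Existence

end Trias

namespace Trias

-- Let `β` be a basis of `V`. By the eleven relations, a product of letters depends only on the word
-- of its letters and on which of them the operations point at. So the free trialgebra has as basis
-- the words in `β` with a nonempty set of marked letters: ⊣ keeps the marks of the left factor, ⊢
-- those of the right factor, ⊥ both (`IsFree.exists_basis`). Hence the complex has a basis of cells
-- `(t; w₀, …, wₙ₋₁)`, every face of a cell is a cell, and acyclicity becomes combinatorial. It is
-- proved with a matching as in discrete Morse theory.
--
-- A word of length at least two is canonically `x ∘ y` with `x` its first letter. The degeneracy
-- `Cell.s k` splits `wₖ` in this way and inserts into `t`, right after leaf `k`, a leaf whose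
-- position is the operation `∘`. The face at `k` undoes this (`Cell.d_s`). If the leaves `0, …, k`
-- are left leaves, then `d (i+1) (s k x) = s k (d i x)` for `k ≤ i` (`Cell.d_succ_s`), because
-- trees and words transform a pair of operations by the same rule `(x ∘ₚ y) ∘_q z = x ∘_r (y ∘ₛ
-- z)`, with `r = p.outer q` and `s = p.inner q`.
--
-- A cell is scanned from the left up to the first position `k` where either `wₖ` is long (the cell
-- is then matched with its `s k`) or the cell already is an `s k` of its own face (it is then
-- matched with that face, `Cell.s_d`). The delicate case is ⊣: since `x ⊣ y` ignores the marks of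
-- `y`, recovering a split needs a normal form, namely `FirstMarked` for the word and `Special` for
-- the tree.
--
-- Let `H` be the signed matching. Then `1 - ∂H - H∂` strictly lowers the filtration by the stopping
-- position (`homotopy_mem`). In degree at least two every cell stops (`Cell.exists_stop`), so every
-- cycle is a boundary. In degree one the cells that do not stop are `(Y; letter)`. They span a copy
-- of `V`, which meets the boundaries trivially because faces contain a word of length at least two.

/-! ### Insertion of leaves into planar trees -/

/-- The operation replacing `r` in the relation `(x ∘ₚ y) ∘_q z = x ∘_r (y ∘ₛ z)`. -/
def Side.outer : Side → Side → Side
  | p, .left => p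
  | _, .right => .right
  | .right, .middle => .right
  | _, .middle => .middle

/-- The operation replacing `s` in the relation `(x ∘ₚ y) ∘_q z = x ∘_r (y ∘ₛ z)`. -/
def Side.inner : Side → Side → Side
  | _, .left => .left
  | _, .right => .right
  | .left, .middle => .right
  | _, .middle => .middle

/-- Apply a function to the first tree of a forest. -/
def PForest.mapHead (g : PTree → PTree) : PForest → PForest
  | .one t => .one (g t)
  | .cons t f => .cons (g t) f

/-- Insert a new leaf right after the `j`-th one, in such a way that its position is `p`, provided
that the leaves up to the `j`-th are left leaves. -/
def PTree.ins (p : Side) : ℕ → PTree → PTree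
  | _, .leaf => .node .leaf (.one .leaf)
  | j, .node (.node t f) g => .node ((PTree.node t f).ins p j) g
  | 0, .node .leaf f => match p with
    | .right => .node (.node .leaf (.one .leaf)) f
    | .middle => .node .leaf (.cons .leaf f)
    | .left => .node .leaf (f.mapHead fun t => .node .leaf (.one t))
  | j + 1, .node .leaf (.one t) => .node .leaf (.one (t.ins p j))
  | j + 1, .node .leaf (.cons t f) => .node .leaf (.cons (t.ins p j) f)

/-- The leaves `0, …, j` exist and are left leaves. -/
inductive LeftTo : ℕ → PTree → Prop
  | base (f : PForest) : LeftTo 0 (.node .leaf f)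
  | spine {j t f} (g : PForest) : LeftTo j (.node t f) → LeftTo j (.node (.node t f) g)
  | one {j t} : LeftTo j t → LeftTo (j + 1) (.node .leaf (.one t))
  | cons {j t} (f : PForest) : LeftTo j t → LeftTo (j + 1) (.node .leaf (.cons t f))

/-- It makes sense to insert a leaf of position `p` right after the `j`-th leaf. -/
inductive Insertable : Side → ℕ → PTree → Prop
  | leaf : Insertable .right 0 .leaf
  | base (p) (f : PForest) : Insertable p 0 (.node .leaf f)
  | spine {p j t f} (g : PForest) :
      Insertable p j (.node t f) → Insertable p j (.node (.node t f) g)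
  | one {p j t} : Insertable p j t → Insertable p (j + 1) (.node .leaf (.one t))
  | cons {p j t} (f : PForest) : Insertable p j t → Insertable p (j + 1) (.node .leaf (.cons t f))

/-- The next sibling of the `j`-th leaf (a left leaf) is of the form `(|, t)`. -/
inductive Special : ℕ → PTree → Prop
  | baseOne (t : PTree) : Special 0 (.node .leaf (.one (.node .leaf (.one t))))
  | baseCons (t : PTree) (f : PForest) : Special 0 (.node .leaf (.cons (.node .leaf (.one t)) f))
  | spine {j t f} (g : PForest) : Special j (.node t f) → Special j (.node (.node t f) g)
  | one {j t} : Special j t → Special (j + 1) (.node .leaf (.one t))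
  | cons {j t} (f : PForest) : Special j t → Special (j + 1) (.node .leaf (.cons t f))

theorem PTree.leaves_node (t : PTree) (f : PForest) :
    (PTree.node t f).leaves = t.leaves + f.leaves := by
  rw [PTree.leaves]

theorem LeftTo.insertable {j t} (h : LeftTo j t) (p : Side) : Insertable p j t := by
  induction h with
  | base f => exact .base p f
  | spine g _ ih => exact .spine g ih
  | one _ ih => exact .one ih
  | cons f _ ih => exact .cons f ih

theorem LeftTo.lt_leaves {j t} (h : LeftTo j t) : j + 1 < t.leaves := by
  induction h with
  | base f => have := f.leaves_pos; simp only [PTree.leaves]; omega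
  | spine g _ ih => have := g.leaves_pos; rw [PTree.leaves]; omega
  | one _ ih => simp only [PTree.leaves, PForest.leaves]; omega
  | cons f _ ih => have := f.leaves_pos; simp only [PTree.leaves, PForest.leaves]; omega

theorem Insertable.lt_leaves {p j t} (h : Insertable p j t) : j < t.leaves := by
  induction h with
  | leaf => simp [PTree.leaves]
  | base p f => have := f.leaves_pos; simp only [PTree.leaves]; omega
  | spine g _ ih => have := g.leaves_pos; rw [PTree.leaves]; omega
  | one _ ih => simp only [PTree.leaves, PForest.leaves]; omega
  | cons f _ ih => have := f.leaves_pos; simp only [PTree.leaves, PForest.leaves]; omega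

theorem Special.lt_leaves {j t} (h : Special j t) : j + 2 < t.leaves := by
  induction h with
  | baseOne t => have := t.leaves_pos; simp only [PTree.leaves, PForest.leaves]; omega
  | baseCons t f =>
    have := t.leaves_pos; have := f.leaves_pos; simp only [PTree.leaves, PForest.leaves]; omega
  | spine g _ ih => have := g.leaves_pos; rw [PTree.leaves]; omega
  | one _ ih => simp only [PTree.leaves, PForest.leaves]; omega
  | cons f _ ih => have := f.leaves_pos; simp only [PTree.leaves, PForest.leaves]; omega

theorem PForest.leaves_mapHead (f : PForest) :
    (f.mapHead fun t => .node .leaf (.one t)).leaves = f.leaves + 1 := by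
  cases f <;> simp only [PForest.mapHead, PForest.leaves, PTree.leaves] <;> omega

theorem Insertable.leaves_ins {p j t} (h : Insertable p j t) :
    (t.ins p j).leaves = t.leaves + 1 := by
  induction h with
  | leaf => rfl
  | base p f =>
    cases p <;> simp only [PTree.ins, PTree.leaves, PForest.leaves, PForest.leaves_mapHead] <;> omega
  | spine g _ ih => rw [PTree.ins, PTree.leaves_node _ g, ih, PTree.leaves_node _ g]; omega
  | one _ ih => simp only [PTree.ins, PTree.leaves, PForest.leaves, ih]; omega
  | cons f _ ih => simp only [PTree.ins, PTree.leaves, PForest.leaves, ih]; omega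

/-! #### Rules for deletions and positions -/

theorem PTree.del_node_of_lt {t t' : PTree} {i : ℕ} (f : PForest) (hi : i < t.leaves)
    (h : t.del i = some t') : (PTree.node t f).del i = some (.node t' f) := by
  simp only [PTree.del, hi, if_true, h]

theorem PTree.del_node_of_le {t : PTree} {i : ℕ} {f f' : PForest} (hi : t.leaves ≤ i)
    (h : f.del (i - t.leaves) = some f') : (PTree.node t f).del i = some (.node t f') := by
  simp only [PTree.del, hi.not_gt, if_false, h]

theorem PTree.del_node_leaf_succ {i : ℕ} {f f' : PForest} (h : f.del i = some f') :
    (PTree.node .leaf f).del (i + 1) = some (.node .leaf f') :=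
  PTree.del_node_of_le (by simp [PTree.leaves]) h

theorem PForest.del_one {t t' : PTree} {i : ℕ} (h : t.del i = some t') :
    (PForest.one t).del i = some (.one t') := by
  simp only [PForest.del, h]

theorem PForest.del_cons_of_lt {t t' : PTree} {i : ℕ} (f : PForest) (hi : i < t.leaves)
    (h : t.del i = some t') : (PForest.cons t f).del i = some (.cons t' f) := by
  simp only [PForest.del, hi, if_true, h]

theorem PForest.del_cons_of_le {t : PTree} {i : ℕ} {f f' : PForest} (hi : t.leaves ≤ i)
    (h : f.del (i - t.leaves) = some f') : (PForest.cons t f).del i = some (.cons t f') := by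
  simp only [PForest.del, hi.not_gt, if_false, h]

theorem PForest.del_cons_eq_one {t : PTree} {i : ℕ} {f : PForest} (hi : t.leaves ≤ i)
    (h : f.del (i - t.leaves) = none) : (PForest.cons t f).del i = some (.one t) := by
  simp only [PForest.del, hi.not_gt, if_false, h]

theorem PTree.del_node_eq_self {t : PTree} {i : ℕ} {f : PForest} (hi : t.leaves ≤ i)
    (h : f.del (i - t.leaves) = none) : (PTree.node t f).del i = some t := by
  simp only [PTree.del, hi.not_gt, if_false, h]

theorem PTree.side_node_of_lt {t : PTree} {i : ℕ} (s : Side) (f : PForest) (hi : i < t.leaves) :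
    (PTree.node t f).side s i = t.side .left i := by
  rw [PTree.side, if_pos hi]

theorem PTree.side_node_leaf_succ (s : Side) (f : PForest) (i : ℕ) :
    (PTree.node .leaf f).side s (i + 1) = f.side i := by
  simp [PTree.side, PTree.leaves]

theorem PForest.side_one (t : PTree) (i : ℕ) : (PForest.one t).side i = t.side .right i := by
  rw [PForest.side]

theorem PForest.side_cons_of_lt {t : PTree} {i : ℕ} (f : PForest) (hi : i < t.leaves) :
    (PForest.cons t f).side i = t.side .middle i := by
  rw [PForest.side, if_pos hi]

/-- Deleting a leaf of the `t` in `node t f`, where `t` has several leaves, inverted. -/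
theorem PTree.del_node_eq_some {t r : PTree} {i : ℕ} {f : PForest} (hi : i < t.leaves)
    (ht : 2 ≤ t.leaves) (h : (PTree.node t f).del i = some r) :
    ∃ t', t.del i = some t' ∧ r = .node t' f := by
  obtain ⟨t', h', -⟩ := PTree.exists_del ht i
  rw [PTree.del_node_of_lt f hi h'] at h
  exact ⟨t', h', (Option.some.inj h).symm⟩

/-- Each base clause of `ins` adds one leaf and at most one vertex; that vertex is binary, so it is
suppressed again when the leaf is deleted. -/
theorem Insertable.del_ins {p j t} (h : Insertable p j t) : (t.ins p j).del (j + 1) = some t := by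
  induction h with
  | leaf => rfl
  | base p f =>
    cases p
    · cases f <;> simp [PTree.ins, PForest.mapHead, PTree.del, PForest.del, PTree.leaves,
        PForest.graft]
    · simp [PTree.ins, PTree.del, PForest.del, PTree.leaves]
    · simp [PTree.ins, PTree.del, PForest.del, PTree.leaves, PForest.leaves]
  | spine g h ih =>
    rw [PTree.ins]
    exact PTree.del_node_of_lt g (by have := h.leaves_ins; have := h.lt_leaves; omega) ih
  | one _ ih => rw [PTree.ins]; exact PTree.del_node_leaf_succ (PForest.del_one ih)
  | cons f h ih =>
    rw [PTree.ins]
    exact PTree.del_node_leaf_succ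
      (PForest.del_cons_of_lt f (by have := h.leaves_ins; have := h.lt_leaves; omega) ih)

theorem Insertable.side_ins {p j t} (h : Insertable p j t) (s : Side) :
    (t.ins p j).side s (j + 1) = p := by
  induction h generalizing s with
  | leaf => rfl
  | base p f =>
    cases p
    · cases f <;> simp [PTree.ins, PForest.mapHead, PTree.side, PForest.side, PTree.leaves]
    · simp [PTree.ins, PTree.side, PForest.side, PTree.leaves]
    · simp [PTree.ins, PTree.side, PForest.side, PTree.leaves, PForest.leaves]
  | spine g h ih =>
    rw [PTree.ins, PTree.side_node_of_lt _ _ (by have := h.leaves_ins; have := h.lt_leaves; omega),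
      ih]
  | one _ ih => rw [PTree.ins, PTree.side_node_leaf_succ, PForest.side_one, ih]
  | cons f h ih =>
    rw [PTree.ins, PTree.side_node_leaf_succ,
      PForest.side_cons_of_lt _ (by have := h.leaves_ins; have := h.lt_leaves; omega), ih]

/-- The case `m = 0` has to be excluded: if the first of several trees is `|`, deleting it promotes
the second tree to the head, and `mapHead` would then change the wrong tree. -/
theorem PForest.del_mapHead {f f' : PForest} {m : ℕ} (hm : 1 ≤ m) (h : f.del m = some f') :
    (f.mapHead fun t => .node .leaf (.one t)).del (m + 1) =
      some (f'.mapHead fun t => .node .leaf (.one t)) := by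
  cases f with
  | one t =>
    rcases h1 : t.del m with _ | t'
    · simp [PForest.del, h1] at h
    · simp only [PForest.del, h1, Option.some.injEq] at h
      subst h
      exact PForest.del_one (PTree.del_node_leaf_succ (PForest.del_one h1))
  | cons t f =>
    by_cases hlt : m < t.leaves
    · obtain ⟨t', h1, h2⟩ := PTree.exists_del (t := t) (by omega) m
      rw [PForest.del_cons_of_lt f hlt h1, Option.some.injEq] at h
      subst h
      exact PForest.del_cons_of_lt _ (by simp only [PTree.leaves, PForest.leaves]; omega)
        (PTree.del_node_leaf_succ (PForest.del_one h1))
    · have e : (PTree.node .leaf (.one t)).leaves = t.leaves + 1 := by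
        simp only [PTree.leaves, PForest.leaves]; omega
      rcases h1 : f.del (m - t.leaves) with _ | f''
      · rw [PForest.del_cons_eq_one (by omega) h1, Option.some.injEq] at h
        subst h
        exact PForest.del_cons_eq_one (e.trans_le (by omega)) (by rw [e, Nat.add_sub_add_right, h1])
      · rw [PForest.del_cons_of_le (by omega) h1, Option.some.injEq] at h
        subst h
        exact PForest.del_cons_of_le (e.trans_le (by omega)) (by rw [e, Nat.add_sub_add_right, h1])

/-- Insertion only affects the neighbourhood of leaf `j` and the root of its next sibling, so it
commutes with the deletion of leaves beyond `j + 1`. Leaf `j + 1` interacts with the insertion and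
is treated in `LeftTo.del_add_two_ins`. -/
theorem LeftTo.del_succ_ins {j t t'} (h : LeftTo j t) (p : Side) {i : ℕ} (hij : j + 1 < i)
    (hi : i < t.leaves) (ht : t.del i = some t') :
    (t.ins p j).del (i + 1) = some (t'.ins p j) := by
  induction h generalizing i t' with
  | base f =>
    obtain ⟨i, rfl⟩ : ∃ k, i = k + 1 := ⟨i - 1, by omega⟩
    rw [PTree.leaves_node, PTree.leaves] at hi
    obtain ⟨f', h1, h2⟩ := PForest.exists_del (f := f) (by omega) i
    rw [PTree.del_node_leaf_succ h1, Option.some.injEq] at ht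
    subst ht
    cases p
    · exact PTree.del_node_leaf_succ (PForest.del_mapHead (by omega) h1)
    · exact PTree.del_node_leaf_succ (PForest.del_cons_of_le (by simp [PTree.leaves]) h1)
    · exact PTree.del_node_of_le (by simp only [PTree.leaves, PForest.leaves]; omega)
        (by simpa [PTree.leaves, PForest.leaves] using h1)
  | @spine j t f g h ih =>
    have h0 := (h.insertable p).leaves_ins
    have h3 := h.lt_leaves
    rw [PTree.ins]
    by_cases hlt : i < (PTree.node t f).leaves
    · obtain ⟨t'', h1, rfl⟩ := PTree.del_node_eq_some hlt (by omega) ht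
      have h2 := PTree.leaves_of_del_some h1
      cases t'' with
      | leaf => simp only [PTree.leaves] at h2 hlt; omega
      | node t₁ f₁ =>
        rw [PTree.ins]
        exact PTree.del_node_of_lt g (by omega) (ih hij hlt h1)
    · have e : i + 1 - ((PTree.node t f).ins p j).leaves = i - (PTree.node t f).leaves := by omega
      rcases h1 : g.del (i - (PTree.node t f).leaves) with _ | g'
      · rw [PTree.del_node_eq_self (by omega) h1, Option.some.injEq] at ht
        subst ht
        exact PTree.del_node_eq_self (by omega) (by rw [e, h1])
      · rw [PTree.del_node_of_le (by omega) h1, Option.some.injEq] at ht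
        subst ht
        rw [PTree.ins]
        exact PTree.del_node_of_le (by omega) (by rw [e, h1])
  | @one j t h ih =>
    obtain ⟨i, rfl⟩ : ∃ k, i = k + 1 := ⟨i - 1, by omega⟩
    simp only [PTree.leaves, PForest.leaves] at hi
    obtain ⟨t'', h1, h2⟩ := PTree.exists_del (t := t) (by omega) i
    rw [PTree.del_node_leaf_succ (PForest.del_one h1), Option.some.injEq] at ht
    subst ht
    rw [PTree.ins, PTree.ins]
    exact PTree.del_node_leaf_succ (PForest.del_one (ih (by omega) (by omega) h1))
  | @cons j t f h ih =>
    have h0 := (h.insertable p).leaves_ins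
    have h3 := h.lt_leaves
    obtain ⟨i, rfl⟩ : ∃ k, i = k + 1 := ⟨i - 1, by omega⟩
    simp only [PTree.leaves, PForest.leaves] at hi
    rw [PTree.ins]
    by_cases hlt : i < t.leaves
    · obtain ⟨t'', h1, h2⟩ := PTree.exists_del (t := t) (by omega) i
      rw [PTree.del_node_leaf_succ (PForest.del_cons_of_lt f hlt h1), Option.some.injEq] at ht
      subst ht
      exact PTree.del_node_leaf_succ
        (PForest.del_cons_of_lt f (by omega) (ih (by omega) (by omega) h1))
    · have e : i + 1 - (t.ins p j).leaves = i - t.leaves := by omega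
      rcases h1 : f.del (i - t.leaves) with _ | f'
      · rw [PTree.del_node_leaf_succ (PForest.del_cons_eq_one (by omega) h1),
          Option.some.injEq] at ht
        subst ht
        exact PTree.del_node_leaf_succ (PForest.del_cons_eq_one (by omega) (by rw [e, h1]))
      · rw [PTree.del_node_leaf_succ (PForest.del_cons_of_le (by omega) h1),
          Option.some.injEq] at ht
        subst ht
        exact PTree.del_node_leaf_succ (PForest.del_cons_of_le (by omega) (by rw [e, h1]))

/-- If deleting the leaf after a left leaf of a tree `node t f` leaves nothing but `|`, that leaf
was a right leaf. -/
theorem LeftTo.eq_zero_and_side_of_del {j t f} (h : LeftTo j (.node t f))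
    (h' : (PTree.node t f).del (j + 1) = some .leaf) (s : Side) :
    j = 0 ∧ (PTree.node t f).side s (j + 1) = .right := by
  have h1 := PTree.leaves_of_del_some h'
  have h2 := h.lt_leaves
  rw [PTree.leaves] at h1
  exact ⟨by omega, PTree.side_node_last _ _ _ _ (by omega)⟩

/-- The four cases: the next sibling of leaf `0` is a leaf or a larger tree, and it is the last
child or not. -/
theorem PForest.del_zero_cases (f : PForest) {r : PTree}
    (h : (PTree.node .leaf f).del 1 = some r) :
    (f = .one .leaf ∧ r = .leaf) ∨
    (∃ t g t', f = .one (.node t g) ∧ (PTree.node t g).del 0 = some t' ∧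
      r = .node .leaf (.one t')) ∨
    (∃ g, f = .cons .leaf g ∧ r = .node .leaf g) ∨
    (∃ t g t' f', f = .cons (.node t g) f' ∧ (PTree.node t g).del 0 = some t' ∧
      r = .node .leaf (.cons t' f')) := by
  have pos : ∀ t g, 2 ≤ (PTree.node t g).leaves := fun t g => by
    have := t.leaves_pos; have := g.leaves_pos; rw [PTree.leaves]; omega
  cases f with
  | one t =>
    cases t with
    | leaf => left; simpa [PTree.del, PForest.del, PTree.leaves, eq_comm] using h
    | node t g =>
      obtain ⟨t', h1, -⟩ := PTree.exists_del (pos t g) 0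
      rw [PTree.del_node_leaf_succ (PForest.del_one h1), Option.some.injEq] at h
      exact .inr (.inl ⟨t, g, t', rfl, h1, h.symm⟩)
  | cons t f =>
    cases t with
    | leaf =>
      right; right; left
      exact ⟨f, rfl, by simpa [PTree.del, PForest.del, PTree.leaves, eq_comm] using h⟩
    | node t g =>
      obtain ⟨t', h1, -⟩ := PTree.exists_del (pos t g) 0
      rw [PTree.del_node_leaf_succ
        (PForest.del_cons_of_lt f (by have := pos t g; omega) h1), Option.some.injEq] at h
      exact .inr (.inr (.inr ⟨t, g, t', f, rfl, h1, h.symm⟩))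

/-- The tree side of `(x ∘ₚ y) ∘_q z = x ∘_r (y ∘ₛ z)`. The new leaf has position `p`, and the old
leaf `j + 1`, of position `q`, becomes leaf `j + 2`. Its position is now `s`, and once it is deleted
the new leaf has position `r`. `MWord.sp_op` and `MWord.tl_op` give the same rule for words. -/
theorem LeftTo.del_add_two_ins {j t t'} (h : LeftTo j t) (p s : Side)
    (ht : t.del (j + 1) = some t') :
    (t.ins p j).del (j + 2) = some (t'.ins (p.outer (t.side s (j + 1))) j) ∧
      (t.ins p j).side s (j + 2) = p.inner (t.side s (j + 1)) := by
  induction h generalizing s t' with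
  | base f =>
    rcases f.del_zero_cases ht with ⟨rfl, rfl⟩ | ⟨t, g, t', rfl, h1, rfl⟩ | ⟨g, rfl, rfl⟩ |
      ⟨t, g, t', f, rfl, h1, rfl⟩
    · cases p <;> exact ⟨rfl, rfl⟩
    · have h2 := t.leaves_pos
      cases p <;> simp [PTree.side_node_leaf_succ, Side.outer, Side.inner,
        PTree.ins, PTree.del, PForest.del, PForest.mapHead, PTree.leaves, PForest.leaves, h2,
        PTree.side, PForest.side, PTree.side_left_zero] <;> simp_all [PTree.del]
    · cases p <;> cases g <;> simp [PTree.side_node_leaf_succ, PForest.side, PTree.side,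
        PTree.ins, PTree.del, PForest.del, PForest.mapHead, PTree.leaves, PForest.leaves,
        Side.outer, Side.inner]
    · have h2 := t.leaves_pos
      cases p <;> simp [PTree.side_node_leaf_succ, Side.outer, Side.inner,
        PTree.ins, PTree.del, PForest.del, PForest.mapHead, PTree.leaves, PForest.leaves, h2,
        PTree.side, PForest.side, PTree.side_left_zero] <;> simp_all [PTree.del]
  | @spine j t f g h ih =>
    have h0 := (h.insertable p).leaves_ins
    have h3 := h.lt_leaves
    obtain ⟨t'', h1, rfl⟩ := PTree.del_node_eq_some h3 (by omega) ht
    obtain ⟨ih1, ih2⟩ := ih .left h1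
    rw [PTree.ins, PTree.side_node_of_lt _ g h3, PTree.side_node_of_lt _ g (by omega), ih2,
      PTree.del_node_of_lt g (by omega) ih1]
    refine ⟨?_, rfl⟩
    -- If the first child shrinks to `|`, insertion falls under the base clause instead of the
    -- recursive one. The deleted leaf was then a right leaf, so `outer` is `right`, for which both
    -- clauses give the same tree.
    cases t'' with
    | leaf =>
      obtain ⟨rfl, h4⟩ := h.eq_zero_and_side_of_del h1 .left
      rw [h4]
      rfl
    | node t₁ f₁ => rw [PTree.ins]
  | @one j t h ih =>
    have h3 := h.lt_leaves
    obtain ⟨t'', h1, h2⟩ := PTree.exists_del (t := t) (by omega) (j + 1)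
    rw [PTree.del_node_leaf_succ (PForest.del_one h1), Option.some.injEq] at ht
    subst ht
    obtain ⟨ih1, ih2⟩ := ih .right h1
    rw [PTree.ins, PTree.ins, PTree.side_node_leaf_succ, PTree.side_node_leaf_succ,
      PForest.side_one, PForest.side_one, PTree.del_node_leaf_succ (PForest.del_one ih1)]
    exact ⟨rfl, ih2⟩
  | @cons j t f h ih =>
    have h0 := (h.insertable p).leaves_ins
    have h3 := h.lt_leaves
    obtain ⟨t'', h1, h2⟩ := PTree.exists_del (t := t) (by omega) (j + 1)
    rw [PTree.del_node_leaf_succ (PForest.del_cons_of_lt f h3 h1), Option.some.injEq] at ht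
    subst ht
    obtain ⟨ih1, ih2⟩ := ih .middle h1
    rw [PTree.ins, PTree.ins, PTree.side_node_leaf_succ, PTree.side_node_leaf_succ,
      PForest.side_cons_of_lt _ h3, PForest.side_cons_of_lt _ (by omega),
      PTree.del_node_leaf_succ (PForest.del_cons_of_lt f (by omega) ih1)]
    exact ⟨rfl, ih2⟩

/-- A deleted right or middle leaf `j + 1` was itself the next sibling of leaf `j`, so its position
determines how to restore it. A deleted left leaf sat deeper, inside the next sibling; insertion
restores only the shape `(|, t)`, which is why `Special` is required. -/
theorem LeftTo.ins_del {j t t'} (h : LeftTo j t) (s : Side) (ht : t.del (j + 1) = some t')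
    (hs : t.side s (j + 1) ≠ .left ∨ Special j t) : t'.ins (t.side s (j + 1)) j = t := by
  induction h generalizing s t' with
  | base f =>
    rcases f.del_zero_cases ht with ⟨rfl, rfl⟩ | ⟨t, g, t', rfl, h1, rfl⟩ | ⟨g, rfl, rfl⟩ |
      ⟨t, g, t', f, rfl, h1, rfl⟩
    · rfl
    · rw [PTree.side_node_leaf_succ, PForest.side_one, PTree.side_node_zero] at hs ⊢
      rcases hs with hs | hs
      · exact absurd rfl hs
      · cases hs
        simp only [PTree.del, PForest.graft, PTree.leaves, Nat.lt_one_iff, if_true,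
          Option.some.injEq] at h1
        subst h1
        rfl
    · rw [PTree.side_node_leaf_succ, PForest.side_cons_of_lt _ (by simp [PTree.leaves])]
      simp [PTree.side, PTree.ins]
    · have e : (PForest.cons (.node t g) f).side 0 = .left := by
        rw [PForest.side_cons_of_lt _ (PTree.leaves_pos _), PTree.side_node_zero]
      rw [PTree.side_node_leaf_succ, e] at hs ⊢
      rcases hs with hs | hs
      · exact absurd rfl hs
      · cases hs
        simp only [PTree.del, PForest.graft, PTree.leaves, Nat.lt_one_iff, if_true,
          Option.some.injEq] at h1
        subst h1
        rfl
  | @spine j t f g h ih =>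
    have h3 := h.lt_leaves
    obtain ⟨t'', h1, rfl⟩ := PTree.del_node_eq_some h3 (by omega) ht
    rw [PTree.side_node_of_lt _ g h3] at hs ⊢
    have ih1 := ih .left h1 (hs.imp_right fun h => by cases h; assumption)
    cases t'' with
    | leaf =>
      obtain ⟨rfl, h4⟩ := h.eq_zero_and_side_of_del h1 .left
      rw [h4] at ih1 ⊢
      rw [← ih1]
      rfl
    | node t₁ f₁ => rw [PTree.ins, ih1]
  | @one j t h ih =>
    have h3 := h.lt_leaves
    obtain ⟨t'', h1, h2⟩ := PTree.exists_del (t := t) (by omega) (j + 1)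
    rw [PTree.del_node_leaf_succ (PForest.del_one h1), Option.some.injEq] at ht
    subst ht
    rw [PTree.side_node_leaf_succ, PForest.side_one] at hs ⊢
    rw [PTree.ins, ih .right h1 (hs.imp_right fun h => by cases h; assumption)]
  | @cons j t f h ih =>
    have h3 := h.lt_leaves
    obtain ⟨t'', h1, h2⟩ := PTree.exists_del (t := t) (by omega) (j + 1)
    rw [PTree.del_node_leaf_succ (PForest.del_cons_of_lt f h3 h1), Option.some.injEq] at ht
    subst ht
    rw [PTree.side_node_leaf_succ, PForest.side_cons_of_lt _ h3] at hs ⊢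
    rw [PTree.ins, ih .middle h1 (hs.imp_right fun h => by cases h; assumption)]

-- Left and insertable leaves under deletion

theorem leftTo_zero_node : (t : PTree) → (f : PForest) → LeftTo 0 (.node t f)
  | .leaf, f => .base f
  | .node t f, g => .spine g (leftTo_zero_node t f)

/-- The next sibling of leaf `j` is not a first child. So if leaf `j + 1` is a left leaf, it is not
this sibling but the first leaf of a larger tree in that place. -/
theorem LeftTo.succ {j t} (h : LeftTo j t) (s : Side) (hs : t.side s (j + 1) = .left) :
    LeftTo (j + 1) t := by
  induction h generalizing s with
  | base f =>
    rw [PTree.side_node_leaf_succ] at hs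
    cases f with
    | one t =>
      cases t with
      | leaf => simp [PForest.side, PTree.side] at hs
      | node t g => exact .one (leftTo_zero_node t g)
    | cons t f =>
      cases t with
      | leaf => simp [PForest.side, PTree.side, PTree.leaves] at hs
      | node t g => exact .cons f (leftTo_zero_node t g)
  | spine g h ih =>
    rw [PTree.side_node_of_lt _ g h.lt_leaves] at hs
    exact .spine g (ih .left hs)
  | one h ih =>
    rw [PTree.side_node_leaf_succ, PForest.side_one] at hs
    exact .one (ih _ hs)
  | cons f h ih =>
    rw [PTree.side_node_leaf_succ, PForest.side_cons_of_lt _ h.lt_leaves] at hs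
    exact .cons f (ih _ hs)

theorem LeftTo.del {j t t'} (h : LeftTo j t) {i : ℕ} (hij : j + 1 < i)
    (hi : i < t.leaves) (ht : t.del i = some t') : LeftTo j t' := by
  induction h generalizing i t' with
  | base f =>
    obtain ⟨i, rfl⟩ : ∃ k, i = k + 1 := ⟨i - 1, by omega⟩
    rw [PTree.leaves_node, PTree.leaves] at hi
    obtain ⟨f', h1, h2⟩ := PForest.exists_del (f := f) (by omega) i
    rw [PTree.del_node_leaf_succ h1, Option.some.injEq] at ht
    subst ht
    exact .base f'
  | @spine j t f g h ih =>
    have h3 := h.lt_leaves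
    by_cases hlt : i < (PTree.node t f).leaves
    · obtain ⟨t'', h1, rfl⟩ := PTree.del_node_eq_some hlt (by omega) ht
      have h2 := PTree.leaves_of_del_some h1
      cases t'' with
      | leaf => simp only [PTree.leaves] at h2 hlt; omega
      | node t₁ f₁ => exact .spine g (ih hij hlt h1)
    · rcases h1 : g.del (i - (PTree.node t f).leaves) with _ | g'
      · rw [PTree.del_node_eq_self (by omega) h1, Option.some.injEq] at ht
        subst ht
        exact h
      · rw [PTree.del_node_of_le (by omega) h1, Option.some.injEq] at ht
        subst ht
        exact .spine g' h
  | @one j t h ih =>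
    obtain ⟨i, rfl⟩ : ∃ k, i = k + 1 := ⟨i - 1, by omega⟩
    simp only [PTree.leaves, PForest.leaves] at hi
    obtain ⟨t'', h1, h2⟩ := PTree.exists_del (t := t) (by omega) i
    rw [PTree.del_node_leaf_succ (PForest.del_one h1), Option.some.injEq] at ht
    subst ht
    exact .one (ih (by omega) (by omega) h1)
  | @cons j t f h ih =>
    have h3 := h.lt_leaves
    obtain ⟨i, rfl⟩ : ∃ k, i = k + 1 := ⟨i - 1, by omega⟩
    simp only [PTree.leaves, PForest.leaves] at hi
    by_cases hlt : i < t.leaves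
    · obtain ⟨t'', h1, h2⟩ := PTree.exists_del (t := t) (by omega) i
      rw [PTree.del_node_leaf_succ (PForest.del_cons_of_lt f hlt h1), Option.some.injEq] at ht
      subst ht
      exact .cons f (ih (by omega) hlt h1)
    · rcases h1 : f.del (i - t.leaves) with _ | f'
      · rw [PTree.del_node_leaf_succ (PForest.del_cons_eq_one (by omega) h1),
          Option.some.injEq] at ht
        subst ht
        exact .one h
      · rw [PTree.del_node_leaf_succ (PForest.del_cons_of_le (by omega) h1),
          Option.some.injEq] at ht
        subst ht
        exact .cons f' h

/-- After the deletion leaf `j` may no longer be a left leaf: the vertex `(|, |)` may collapse to a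
middle or right child. Only a right leaf can be inserted there, but in this case the deleted leaf
was a right leaf and `hr` applies. -/
theorem LeftTo.insertable_del {j t t'} (h : LeftTo j t) (s r : Side)
    (ht : t.del (j + 1) = some t') (hr : t.side s (j + 1) = .right → r = .right) :
    Insertable r j t' := by
  induction h generalizing s t' with
  | base f =>
    rcases f.del_zero_cases ht with ⟨rfl, rfl⟩ | ⟨t, g, t', rfl, h1, rfl⟩ | ⟨g, rfl, rfl⟩ |
      ⟨t, g, t', f, rfl, h1, rfl⟩
    · rw [hr rfl]; exact .leaf
    all_goals exact .base _ _
  | @spine j t f g h ih =>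
    have h3 := h.lt_leaves
    obtain ⟨t'', h1, rfl⟩ := PTree.del_node_eq_some h3 (by omega) ht
    rw [PTree.side_node_of_lt _ g h3] at hr
    cases t'' with
    | leaf =>
      obtain ⟨rfl, h4⟩ := h.eq_zero_and_side_of_del h1 .left
      exact .base _ _
    | node t₁ f₁ => exact .spine g (ih .left h1 hr)
  | @one j t h ih =>
    have h3 := h.lt_leaves
    obtain ⟨t'', h1, h2⟩ := PTree.exists_del (t := t) (by omega) (j + 1)
    rw [PTree.del_node_leaf_succ (PForest.del_one h1), Option.some.injEq] at ht
    subst ht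
    rw [PTree.side_node_leaf_succ, PForest.side_one] at hr
    exact .one (ih _ h1 hr)
  | @cons j t f h ih =>
    have h3 := h.lt_leaves
    obtain ⟨t'', h1, h2⟩ := PTree.exists_del (t := t) (by omega) (j + 1)
    rw [PTree.del_node_leaf_succ (PForest.del_cons_of_lt f h3 h1), Option.some.injEq] at ht
    subst ht
    rw [PTree.side_node_leaf_succ, PForest.side_cons_of_lt _ h3] at hr
    exact .cons f (ih _ h1 hr)

/-! #### Special leaves -/

/-- Only the right comb has all leaves but the last on the left, and there every left leaf but the
last one is special. -/
theorem LeftTo.special_of_leaves {j t} (h : LeftTo (j + 1) t) (ht : t.leaves = j + 3) :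
    Special j t := by
  generalize hk : j + 1 = k at h
  induction h generalizing j with
  | base f => omega
  | spine g h =>
    have := h.lt_leaves
    have := g.leaves_pos
    rw [PTree.leaves_node _ g] at ht
    omega
  | @one k t h ih =>
    rw [PTree.leaves_node, PTree.leaves, PForest.leaves] at ht
    cases j with
    | zero =>
      cases t with
      | leaf => cases h
      | node t f =>
        have := t.leaves_pos
        have := f.leaves_pos
        rw [PTree.leaves_node] at ht
        cases t with
        | leaf =>
          cases f with
          | one t => exact .baseOne t
          | cons t f =>
            have := t.leaves_pos
            have := f.leaves_pos
            rw [PTree.leaves, PForest.leaves] at ht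
            omega
        | node t g =>
          have := t.leaves_pos
          have := g.leaves_pos
          rw [PTree.leaves_node t g] at ht
          omega
    | succ j => exact .one (ih (by omega) (by omega))
  | cons f h =>
    have := h.lt_leaves
    have := f.leaves_pos
    rw [PTree.leaves_node, PTree.leaves, PForest.leaves] at ht
    omega

theorem LeftTo.special_ins {j t} (h : LeftTo j t) : Special j (t.ins .left j) := by
  induction h with
  | base f => cases f <;> simp only [PTree.ins, PForest.mapHead] <;> constructor
  | @spine j t f g h ih =>
    rw [PTree.ins]
    generalize (PTree.node t f).ins .left j = r at ih
    cases ih <;> exact .spine g (by constructor <;> assumption)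
  | one _ ih => rw [PTree.ins]; exact .one ih
  | cons f _ ih => rw [PTree.ins]; exact .cons f ih

theorem Special.spine' {j t} (h : Special j t) (g : PForest) : Special j (.node t g) := by
  cases h <;> exact .spine g (by constructor <;> assumption)

/-- Here leaf `j + 1` is the next sibling of leaf `j`, and insertion replaces it by `(|, |)`. -/
theorem Insertable.special_ins_of_side_ne {p j t} (h : Insertable p (j + 1) t) (s : Side)
    (hs : t.side s (j + 1) ≠ .left) : Special j (t.ins p (j + 1)) := by
  generalize hk : j + 1 = k at h
  induction h generalizing j s with
  | leaf => omega
  | base p f => omega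
  | spine g h ih =>
    rw [PTree.side_node_of_lt _ g (hk ▸ h.lt_leaves)] at hs
    rw [PTree.ins]
    exact (ih _ hs hk).spine' g
  | @one p k t h ih =>
    rw [PTree.side_node_leaf_succ, PForest.side_one] at hs
    rw [PTree.ins]
    obtain rfl : j = k := by omega
    cases j with
    | zero =>
      cases t with
      | leaf => exact .baseOne _
      | node t g => exact absurd (PTree.side_node_zero t g _) hs
    | succ j => exact .one (ih _ hs rfl)
  | @cons p k t f h ih =>
    obtain rfl : j = k := by omega
    rw [PTree.side_node_leaf_succ, PForest.side_cons_of_lt _ h.lt_leaves] at hs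
    rw [PTree.ins]
    cases j with
    | zero =>
      cases t with
      | leaf => exact .baseCons _ _
      | node t g => exact absurd (PTree.side_node_zero t g _) hs
    | succ j => exact .cons f (ih _ hs rfl)

theorem Special.ins_of_le {j t} (h : Special j t) (p : Side) {k : ℕ} (hk : j + 2 ≤ k) :
    Special j (t.ins p k) := by
  induction h generalizing k with
  | baseOne t =>
    obtain ⟨k, rfl⟩ : ∃ l, k = l + 2 := ⟨k - 2, by omega⟩
    exact .baseOne _
  | baseCons t f =>
    obtain ⟨k, rfl⟩ : ∃ l, k = l + 2 := ⟨k - 2, by omega⟩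
    exact .baseCons _ _
  | spine g _ ih => rw [PTree.ins]; exact (ih hk).spine' g
  | one _ ih =>
    obtain ⟨k, rfl⟩ : ∃ l, k = l + 1 := ⟨k - 1, by omega⟩
    exact .one (ih (by omega))
  | cons f _ ih =>
    obtain ⟨k, rfl⟩ : ∃ l, k = l + 1 := ⟨k - 1, by omega⟩
    exact .cons f (ih (by omega))

/-- The sibling `(|, t)` becomes `(|, (|, t))`. The other two positions would give `(|, |, t)` and
`((|, |), t)`, which do not have the required shape. -/
theorem Special.ins_left_succ {j t} (h : Special j t) : Special j (t.ins .left (j + 1)) := by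
  induction h with
  | baseOne t => exact .baseOne _
  | baseCons t f => exact .baseCons _ _
  | spine g _ ih => rw [PTree.ins]; exact ih.spine' g
  | one _ ih => exact .one ih
  | cons f _ ih => exact .cons f ih

/-- Leaf `j + 2` is the first leaf of the `t` in `(|, t)`. A later leaf lies outside that subtree,
or is not its only leaf, so its deletion preserves the shape `(|, t)`. -/
theorem Special.del {j t t'} (h : Special j t) {i : ℕ} (hij : j + 2 < i)
    (hi : i < t.leaves) (ht : t.del i = some t') : Special j t' := by
  induction h generalizing i t' with
  | baseOne t =>
    obtain ⟨i, rfl⟩ : ∃ k, i = k + 2 := ⟨i - 2, by omega⟩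
    simp only [PTree.leaves, PForest.leaves] at hi
    obtain ⟨r, h1, h2⟩ := PTree.exists_del (t := t) (by omega) i
    rw [PTree.del_node_leaf_succ (PForest.del_one (PTree.del_node_leaf_succ
      (PForest.del_one h1))), Option.some.injEq] at ht
    subst ht
    exact .baseOne _
  | baseCons t f =>
    obtain ⟨i, rfl⟩ : ∃ k, i = k + 2 := ⟨i - 2, by omega⟩
    simp only [PTree.leaves, PForest.leaves] at hi
    have e : (PTree.node .leaf (.one t)).leaves = t.leaves + 1 := by
      simp only [PTree.leaves, PForest.leaves]; omega
    by_cases hlt : i < t.leaves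
    · obtain ⟨r, h1, h2⟩ := PTree.exists_del (t := t) (by omega) i
      rw [PTree.del_node_leaf_succ (PForest.del_cons_of_lt _ (by omega) (PTree.del_node_leaf_succ
        (PForest.del_one h1))), Option.some.injEq] at ht
      subst ht
      exact .baseCons _ _
    · rcases h1 : f.del (i + 1 - (PTree.node .leaf (.one t)).leaves) with _ | f'
      · rw [PTree.del_node_leaf_succ (PForest.del_cons_eq_one (by omega) h1),
          Option.some.injEq] at ht
        subst ht
        exact .baseOne _
      · rw [PTree.del_node_leaf_succ (PForest.del_cons_of_le (by omega) h1),
          Option.some.injEq] at ht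
        subst ht
        exact .baseCons _ _
  | @spine j t f g h ih =>
    have h3 := h.lt_leaves
    by_cases hlt : i < (PTree.node t f).leaves
    · obtain ⟨t'', h1, rfl⟩ := PTree.del_node_eq_some hlt (by omega) ht
      exact (ih hij hlt h1).spine' g
    · rcases h1 : g.del (i - (PTree.node t f).leaves) with _ | g'
      · rw [PTree.del_node_eq_self (by omega) h1, Option.some.injEq] at ht
        subst ht
        exact h
      · rw [PTree.del_node_of_le (by omega) h1, Option.some.injEq] at ht
        subst ht
        exact h.spine' g'
  | @one j t h ih =>
    obtain ⟨i, rfl⟩ : ∃ k, i = k + 1 := ⟨i - 1, by omega⟩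
    simp only [PTree.leaves, PForest.leaves] at hi
    obtain ⟨t'', h1, h2⟩ := PTree.exists_del (t := t) (by omega) i
    rw [PTree.del_node_leaf_succ (PForest.del_one h1), Option.some.injEq] at ht
    subst ht
    exact .one (ih (by omega) (by omega) h1)
  | @cons j t f h ih =>
    have h3 := h.lt_leaves
    obtain ⟨i, rfl⟩ : ∃ k, i = k + 1 := ⟨i - 1, by omega⟩
    simp only [PTree.leaves, PForest.leaves] at hi
    by_cases hlt : i < t.leaves
    · obtain ⟨t'', h1, h2⟩ := PTree.exists_del (t := t) (by omega) i
      rw [PTree.del_node_leaf_succ (PForest.del_cons_of_lt f hlt h1), Option.some.injEq] at ht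
      subst ht
      exact .cons f (ih (by omega) hlt h1)
    · rcases h1 : f.del (i - t.leaves) with _ | f'
      · rw [PTree.del_node_leaf_succ (PForest.del_cons_eq_one (by omega) h1),
          Option.some.injEq] at ht
        subst ht
        exact .one h
      · rw [PTree.del_node_leaf_succ (PForest.del_cons_of_le (by omega) h1),
          Option.some.injEq] at ht
        subst ht
        exact .cons f' h

/-- Deleting the second next leaf of a special leaf. -/
theorem Special.del_add_two {j t t'} (h : Special j t) (s : Side) (ht : t.del (j + 2) = some t') :
    t'.side s (j + 1) ≠ .left ∨ (t.side s (j + 2) = .left ∧ Special j t') := by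
  induction h generalizing s t' with
  | baseOne t =>
    cases t with
    | leaf =>
      left
      simp only [PTree.del, PForest.del, PTree.leaves] at ht
      simp at ht
      subst ht
      simp [PTree.side, PForest.side, PTree.leaves]
    | node t f =>
      have := t.leaves_pos
      have := f.leaves_pos
      obtain ⟨r, h1, h2⟩ := PTree.exists_del (t := .node t f) (by rw [PTree.leaves]; omega) 0
      right
      rw [PTree.del_node_leaf_succ (PForest.del_one (PTree.del_node_leaf_succ
        (PForest.del_one h1))), Option.some.injEq] at ht
      subst ht
      rw [PTree.side_node_leaf_succ, PForest.side_one, PTree.side_node_leaf_succ, PForest.side_one]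
      exact ⟨PTree.side_node_zero t f _, .baseOne _⟩
  | baseCons t g =>
    cases t with
    | leaf =>
      left
      simp only [PTree.del, PForest.del, PTree.leaves, PForest.leaves] at ht
      simp at ht
      subst ht
      simp [PTree.side, PForest.side, PTree.leaves]
    | node t f =>
      have := t.leaves_pos
      have := f.leaves_pos
      have e : (PTree.node .leaf (.one (.node t f))).leaves = t.leaves + f.leaves + 1 := by
        simp only [PTree.leaves, PForest.leaves]; omega
      obtain ⟨r, h1, h2⟩ := PTree.exists_del (t := .node t f) (by rw [PTree.leaves]; omega) 0
      right
      rw [PTree.del_node_leaf_succ (PForest.del_cons_of_lt g (by omega) (PTree.del_node_leaf_succ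
        (PForest.del_one h1))), Option.some.injEq] at ht
      subst ht
      rw [PTree.side_node_leaf_succ, PForest.side_cons_of_lt _ (by omega),
        PTree.side_node_leaf_succ, PForest.side_one]
      exact ⟨PTree.side_node_zero t f _, .baseCons _ _⟩
  | @spine j t f g h ih =>
    have h3 := h.lt_leaves
    obtain ⟨t'', h1, rfl⟩ := PTree.del_node_eq_some h3 (by omega) ht
    have h2 := PTree.leaves_of_del_some h1
    rw [PTree.side_node_of_lt _ g (by omega), PTree.side_node_of_lt _ g (by omega)]
    exact (ih .left h1).imp_right fun h => ⟨h.1, h.2.spine' g⟩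
  | @one j t h ih =>
    have h3 := h.lt_leaves
    obtain ⟨t'', h1, h2⟩ := PTree.exists_del (t := t) (by omega) (j + 2)
    rw [PTree.del_node_leaf_succ (PForest.del_one h1), Option.some.injEq] at ht
    subst ht
    rw [PTree.side_node_leaf_succ, PForest.side_one, PTree.side_node_leaf_succ, PForest.side_one]
    exact (ih .right h1).imp_right fun h => ⟨h.1, .one h.2⟩
  | @cons j t f h ih =>
    have h3 := h.lt_leaves
    obtain ⟨t'', h1, h2⟩ := PTree.exists_del (t := t) (by omega) (j + 2)
    rw [PTree.del_node_leaf_succ (PForest.del_cons_of_lt f h3 h1), Option.some.injEq] at ht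
    subst ht
    rw [PTree.side_node_leaf_succ, PForest.side_cons_of_lt _ (by omega), PTree.side_node_leaf_succ,
      PForest.side_cons_of_lt _ h3]
    exact (ih .middle h1).imp_right fun h => ⟨h.1, .cons f h.2⟩

/-! ### Marked words -/

/-- Forget all marks. -/
def unmark {β : Type v} (l : List (β × Bool)) : List (β × Bool) := l.map fun c => (c.1, false)

/-- Mark the first letter only. -/
def markFirst {β : Type v} : List (β × Bool) → List (β × Bool)
  | [] => []
  | c :: l => (c.1, true) :: unmark l

section
variable {β : Type v}

@[simp] theorem length_unmark (l : List (β × Bool)) : (unmark l).length = l.length := by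
  simp [unmark]

@[simp] theorem unmark_unmark (l : List (β × Bool)) : unmark (unmark l) = unmark l := by
  simp [unmark]

@[simp] theorem unmark_append (l m : List (β × Bool)) :
    unmark (l ++ m) = unmark l ++ unmark m := by
  simp [unmark]

@[simp] theorem unmark_cons (c : β × Bool) (l : List (β × Bool)) :
    unmark (c :: l) = (c.1, false) :: unmark l := rfl

@[simp] theorem any_unmark (l : List (β × Bool)) : (unmark l).any Prod.snd = false := by
  simp [unmark]

theorem unmark_eq_self {l : List (β × Bool)} (h : l.any Prod.snd = false) : unmark l = l := by
  induction l with
  | nil => rfl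
  | cons c l ih =>
    rw [List.any_cons, Bool.or_eq_false_iff] at h
    rw [unmark_cons, ih h.2, ← h.1]

@[simp] theorem unmark_markFirst (l : List (β × Bool)) : unmark (markFirst l) = unmark l := by
  cases l <;> simp [markFirst]

end

/-- Words in `β` with some letters marked, at least one of them. -/
@[ext] structure MWord (β : Type v) : Type v where
  letters : List (β × Bool)
  marked : letters.any Prod.snd = true

namespace MWord

variable {β : Type v}

def len (x : MWord β) : ℕ := x.1.length

/-- The concatenation of words, in which only the marks of the left or right factor, or those of
both factors, are kept. -/
def op : Side → MWord β → MWord β → MWord β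
  | .left, x, y => ⟨x.1 ++ unmark y.1, by simp [x.2]⟩
  | .right, x, y => ⟨unmark x.1 ++ y.1, by simp [y.2]⟩
  | .middle, x, y => ⟨x.1 ++ y.1, by simp [x.2]⟩

/-- The word with a single letter. -/
def single (b : β) : MWord β := ⟨[(b, true)], rfl⟩

theorem assoc {p q r s : Side} (h : Compat p q r s) (x y z : MWord β) :
    op q (op p x y) z = op r x (op s y z) := by
  apply MWord.ext
  cases p <;> cases q <;> cases r <;> cases s <;> first | exact h.elim | skip
  all_goals simp [op]

theorem len_pos (x : MWord β) : 0 < x.len := by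
  obtain ⟨l, hl⟩ := x
  cases l with
  | nil => simp at hl
  | cons c l => simp [len]

@[simp] theorem len_op (s : Side) (x y : MWord β) : (op s x y).len = x.len + y.len := by
  cases s <;> simp [op, len]

/-- The first letter, as a word. -/
def hd : MWord β → MWord β
  | ⟨[], h⟩ => ⟨[], h⟩
  | ⟨(b, _) :: _, _⟩ => single b

/-- A word `y` such that the given word is a product of its first letter and `y`: all but the first
letter, and if there is no mark left, the first letter of `y` is marked. -/
def tl : MWord β → MWord β
  | ⟨[], h⟩ => ⟨[], h⟩
  | ⟨[c], h⟩ => ⟨[c], h⟩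
  | ⟨_ :: c :: l, _⟩ =>
    if h : (c :: l).any Prod.snd = true then ⟨c :: l, h⟩ else ⟨markFirst (c :: l), by
      simp [markFirst]⟩

/-- The operation producing a word from its first letter and the rest. -/
def sp (x : MWord β) : Side :=
  match x.1 with
  | [] => .right
  | (_, false) :: _ => .right
  | (_, true) :: l => if l.any Prod.snd = true then .middle else .left

/-- Only the first letter is marked. -/
def FirstMarked (x : MWord β) : Prop := markFirst x.1 = x.1

theorem exists_cons_cons {x : MWord β} (h : 2 ≤ x.len) :
    ∃ b m c l h', x = ⟨(b, m) :: c :: l, h'⟩ := by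
  obtain ⟨l, hl⟩ := x
  rcases l with _ | ⟨⟨b, m⟩, _ | ⟨c, l⟩⟩
  · simp [len] at h
  · simp [len] at h
  · exact ⟨b, m, c, l, hl, rfl⟩

theorem eq_single {x : MWord β} (h : x.len = 1) : ∃ b, x = single b := by
  obtain ⟨l, hl⟩ := x
  rcases l with _ | ⟨⟨b, m⟩, _ | ⟨c, l⟩⟩
  · simp [len] at h
  · simp at hl
    subst hl
    exact ⟨b, rfl⟩
  · simp [len] at h

theorem exists_cons (x : MWord β) : ∃ b m l h', x = ⟨(b, m) :: l, h'⟩ := by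
  obtain ⟨l, hl⟩ := x
  rcases l with _ | ⟨⟨b, m⟩, l⟩
  · simp at hl
  · exact ⟨b, m, l, hl, rfl⟩

theorem tl_of_any (d : β × Bool) {c : β × Bool} {l} (h) (h') :
    tl ⟨d :: c :: l, h⟩ = ⟨c :: l, h'⟩ := by
  rw [tl, dif_pos h']

theorem tl_of_not_any (d : β × Bool) {c : β × Bool} {l} (h)
    (h' : ¬ (c :: l).any Prod.snd = true) :
    tl ⟨d :: c :: l, h⟩ = ⟨markFirst (c :: l), by simp [markFirst]⟩ := by
  rw [tl, dif_neg h']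

theorem len_hd (x : MWord β) : x.hd.len = 1 := by
  obtain ⟨b, m, l, h, rfl⟩ := x.exists_cons
  rfl

theorem len_tl {x : MWord β} (h : 2 ≤ x.len) : x.len = x.tl.len + 1 := by
  obtain ⟨b, m, c, l, hl, rfl⟩ := exists_cons_cons h
  by_cases h' : (c :: l).any Prod.snd = true
  · rw [tl_of_any _ _ h']; rfl
  · rw [tl_of_not_any _ _ h']; simp [len, markFirst]

/-- If no mark is left after the first letter, the operation is ⊣, which discards the artificial
mark that `tl` puts on its first letter. -/
theorem op_hd_tl {x : MWord β} (h : 2 ≤ x.len) : op x.sp x.hd x.tl = x := by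
  obtain ⟨b, m, c, l, hl, rfl⟩ := exists_cons_cons h
  apply MWord.ext
  cases m
  · rw [tl_of_any _ _ (by simpa using hl)]
    rfl
  · by_cases h' : (c :: l).any Prod.snd = true
    · rw [tl_of_any _ _ h']
      simp only [sp, h', if_true]
      rfl
    · rw [tl_of_not_any _ _ h']
      simp only [sp, h', if_false, op, Bool.false_eq_true]
      rw [unmark_markFirst, unmark_eq_self (Bool.eq_false_iff.2 h')]
      rfl

theorem hd_op (s : Side) (x y : MWord β) : (op s x y).hd = x.hd := by
  obtain ⟨b, m, l, h, rfl⟩ := x.exists_cons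
  cases s <;> rfl

theorem hd_of_len {x : MWord β} (h : x.len = 1) : x.hd = x := by
  obtain ⟨b, rfl⟩ := eq_single h
  rfl

theorem sp_op {x : MWord β} (h : 2 ≤ x.len) (s : Side) (y : MWord β) :
    (op s x y).sp = x.sp.outer s := by
  obtain ⟨b, m, c, l, hl, rfl⟩ := exists_cons_cons h
  cases m
  · cases s <;> simp [op, sp, Side.outer]
  · by_cases h' : (c :: l).any Prod.snd = true <;>
      cases s <;> simp_all [op, sp, Side.outer, y.2]

/-- For `p = q = left` the relations leave the inner operation free. The value `left` in
`Side.inner` is the one compatible with the normal form: multiplying a word marked only at its first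
letter by `⊣ y` adds no marks. -/
theorem tl_op {x : MWord β} (h : 2 ≤ x.len) (s : Side) (y : MWord β) :
    (op s x y).tl = op (x.sp.inner s) x.tl y := by
  obtain ⟨b, m, c, l, hl, rfl⟩ := exists_cons_cons h
  obtain ⟨y, hy⟩ := y
  by_cases h' : (c :: l).any Prod.snd = true
  · have h1 : (c :: (l ++ y)).any Prod.snd = true := by
      rw [← List.cons_append, List.any_append, h']; rfl
    have h2 : (c :: (l ++ unmark y)).any Prod.snd = true := by
      rw [← List.cons_append, List.any_append, h']; rfl
    have h3 : (unmark (c :: l) ++ y).any Prod.snd = true := by rw [List.any_append, hy]; simp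
    rw [tl_of_any _ _ h']
    cases s
    · exact (tl_of_any _ _ h2).trans (by simp [Side.inner, op])
    · exact (tl_of_any _ _ h1).trans (by cases m <;> simp [sp, h', Side.inner, op])
    · exact (tl_of_any _ _ h3).trans (by simp [Side.inner, op, unmark])
  · obtain rfl : m = true := by simpa [h'] using hl
    have h1 : (c :: (l ++ y)).any Prod.snd = true := by
      rw [← List.cons_append, List.any_append, hy]; simp
    have h2 : ¬ (c :: (l ++ unmark y)).any Prod.snd = true := by
      rw [← List.cons_append, List.any_append, Bool.eq_false_iff.2 h']; simp
    have h3 : (unmark (c :: l) ++ y).any Prod.snd = true := by rw [List.any_append, hy]; simp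
    have h4 := unmark_eq_self (Bool.eq_false_iff.2 h')
    rw [unmark_cons, List.cons.injEq] at h4
    have h5 : sp ⟨(b, true) :: c :: l, hl⟩ = .left := by simp only [sp, h']; rfl
    rw [tl_of_not_any _ _ h', h5]
    cases s
    · exact (tl_of_not_any _ _ h2).trans (by simp [Side.inner, op, markFirst])
    · exact (tl_of_any _ _ h1).trans (by simp [Side.inner, op, markFirst, h4])
    · refine (tl_of_any _ _ h3).trans (MWord.ext ?_)
      change _ = unmark (markFirst (c :: l)) ++ y
      rw [unmark_markFirst]
      rfl

theorem sp_op_of_len {x : MWord β} (h : x.len = 1) (s : Side) (y : MWord β) :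
    (op s x y).sp = s := by
  obtain ⟨b, rfl⟩ := eq_single h
  cases s <;> simp [op, sp, single, y.2]

/-- A product `x ⊣ y` forgets the marks of `y`; `y` is recovered exactly when its marks are those
which `tl` restores. -/
theorem tl_op_of_len {x : MWord β} (h : x.len = 1) {s : Side} {y : MWord β}
    (hy : s ≠ .left ∨ y.FirstMarked) : (op s x y).tl = y := by
  obtain ⟨b, rfl⟩ := eq_single h
  obtain ⟨c, m, l, hl, rfl⟩ := y.exists_cons
  cases s
  · have hy' : markFirst ((c, m) :: l) = (c, m) :: l := by simpa [FirstMarked] using hy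
    refine (tl_of_not_any (b, true) (c := (c, false)) (l := unmark l) _ ?_).trans (MWord.ext ?_)
    · simp
    · exact Eq.trans (by simp [markFirst]) hy'
  · exact tl_of_any _ _ hl
  · exact tl_of_any _ _ hl

theorem firstMarked_markFirst (l : List (β × Bool)) : markFirst (markFirst l) = markFirst l := by
  cases l <;> simp [markFirst]

theorem firstMarked_of_len {x : MWord β} (h : x.len = 1) : x.FirstMarked := by
  obtain ⟨b, rfl⟩ := eq_single h
  rfl

theorem firstMarked_tl {x : MWord β} (h : 2 ≤ x.len) (hx : x.sp = .left) : x.tl.FirstMarked := by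
  obtain ⟨b, m, c, l, hl, rfl⟩ := exists_cons_cons h
  by_cases h' : (c :: l).any Prod.snd = true
  · cases m <;> simp [sp, h'] at hx
  · rw [tl_of_not_any _ _ h']
    exact firstMarked_markFirst (c :: l)

theorem FirstMarked.op_left {x : MWord β} (h : x.FirstMarked) (y : MWord β) :
    (op .left x y).FirstMarked := by
  obtain ⟨b, m, l, hl, rfl⟩ := x.exists_cons
  simp_all [op, markFirst, FirstMarked]

theorem FirstMarked.sp {x : MWord β} (h : x.FirstMarked) : x.sp = .left := by
  obtain ⟨b, m, l, hl, rfl⟩ := x.exists_cons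
  simp only [FirstMarked, markFirst, List.cons.injEq, Prod.mk.injEq, true_and] at h
  obtain ⟨rfl, h⟩ := h
  have : l.any Prod.snd = false := by rw [← h]; simp
  simp [MWord.sp, this]

end MWord

/-! ### The cells of the complex and their matching -/

/-- Needed without `Insertable`, so that `T.ins` and the degeneracies are total functions. -/
theorem PTree.leaves_ins (p : Side) (j : ℕ) (t : PTree) :
    (t.ins p j).leaves = t.leaves + 1 := by
  induction j, t using PTree.ins.induct p with
  | case1 => rfl
  | case2 j t f g ih => rw [PTree.ins, PTree.leaves_node _ g, ih, PTree.leaves_node _ g]; omega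
  | case6 j t ih => simp only [PTree.ins, PTree.leaves, PForest.leaves, ih]; omega
  | case7 j t f ih => simp only [PTree.ins, PTree.leaves, PForest.leaves, ih]; omega
  | _ f =>
    simp only [PTree.ins]
    split <;> simp only [PTree.leaves, PForest.leaves, PForest.leaves_mapHead] <;> omega

def T.ins {n : ℕ} (p : Side) (j : ℕ) (t : T n) : T (n + 1) :=
  ⟨t.1.ins p j, by rw [PTree.leaves_ins, t.2]⟩

theorem T.face_eq {n : ℕ} {t : T (n + 1)} {t' : T n} {i : ℕ} (h : t.1.del i = some t'.1) :
    t.face i = t' := by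
  rw [T.del_eq, Option.some.injEq] at h
  exact Subtype.ext h

section
variable {n : ℕ} {p : Side} {k : ℕ}

theorem T.face_ins {t : T n} (h : Insertable p k t.1) : (t.ins p k).face (k + 1) = t :=
  T.face_eq h.del_ins

theorem T.side_ins {t : T n} (h : Insertable p k t.1) : (t.ins p k).side (k + 1) = p :=
  h.side_ins _

theorem T.face_succ_ins {t : T (n + 1)} (h : LeftTo k t.1) {i : ℕ} (hk : k + 1 < i)
    (hi : i < n + 2) : (t.ins p k).face (i + 1) = (t.face i).ins p k :=
  T.face_eq (h.del_succ_ins p hk (by rw [t.2]; omega) (t.del_eq i))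

theorem T.face_add_two_ins {t : T (n + 1)} (h : LeftTo k t.1) :
    (t.ins p k).face (k + 2) = (t.face (k + 1)).ins (p.outer (t.side (k + 1))) k :=
  T.face_eq (h.del_add_two_ins p _ (t.del_eq _)).1

theorem T.side_add_two_ins {t : T (n + 1)} (h : LeftTo k t.1) :
    (t.ins p k).side (k + 2) = p.inner (t.side (k + 1)) :=
  (h.del_add_two_ins p _ (t.del_eq _)).2

/-- As `t` is a face of `t.ins p k`, this is the rule for positions of leaves not adjacent to a
deleted one, read backwards. -/
theorem T.side_ins_of_lt {t : T n} (h : Insertable p k t.1) {j : ℕ} (hj : j < k) (hk : k < n) :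
    (t.ins p k).side j = t.side j := by
  have := T.side_face_of_lt (t.ins p k) j (k + 1) (by omega) (by omega)
  rw [T.face_ins h] at this
  exact this.symm

theorem T.side_ins_of_gt {t : T n} (h : Insertable p k t.1) {j : ℕ} (hj : k + 1 < j)
    (hn : j < n + 1) : (t.ins p k).side (j + 1) = t.side j := by
  have := T.side_face_of_gt (t.ins p k) (k + 1) (j + 1) (by omega) (by omega)
  rw [T.face_ins h] at this
  exact this.symm

end

/-- The elements of the standard basis of the complex in degree `n`. -/
abbrev Cell (β : Type v) (n : ℕ) : Type v := T n × (Fin n → MWord β)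

variable {β : Type v}

namespace Cell

/-- The faces of a cell. -/
def d {n : ℕ} (i : Fin n) (x : Cell β (n + 1)) : Cell β n :=
  (x.1.face (i + 1), Fin.contractNth i.castSucc (MWord.op (x.1.side (i + 1))) x.2)

/-- Split one word of a sequence into its first letter and the rest. -/
def splitNth {n : ℕ} (k : Fin n) (a : Fin n → MWord β) : Fin (n + 1) → MWord β := fun i =>
  if h : (i : ℕ) < k then a ⟨i, h.trans k.2⟩ else if (i : ℕ) = k then (a k).hd else
    if (i : ℕ) = k + 1 then (a k).tl else a ⟨i - 1, by omega⟩

/-- The partially defined degeneracies of a cell. -/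
def s {n : ℕ} (k : Fin n) (x : Cell β n) : Cell β (n + 1) :=
  (x.1.ins (x.2 k).sp k, splitNth k x.2)

/-- The matching of a cell is determined at the position `j` (provided that it is not determined at
an earlier one). -/
def Stop {n : ℕ} (j : ℕ) (x : Cell β n) : Prop :=
  ∃ h : j < n, 2 ≤ (x.2 ⟨j, h⟩).len ∨ ∃ h' : j + 1 < n,
    x.1.side (j + 1) ≠ .left ∨ (Special j x.1.1 ∧ (x.2 ⟨j + 1, h'⟩).FirstMarked)

/-- With sequences indexed by `ℕ`, identities between contractions and splittings reduce to case
distinctions on natural numbers. -/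
theorem exists_nat_fun' {α : Type v} {n : ℕ} (k : Fin n) (a : Fin n → α) :
    ∃ b : ℕ → α, a = fun k : Fin n => b (k : ℕ) :=
  ⟨fun m => if hm : m < n then a ⟨m, hm⟩ else a k, by ext k; simp⟩

theorem exists_nat_fun {α : Type v} {n : ℕ} (a : Fin (n + 1) → α) :
    ∃ b : ℕ → α, a = fun k : Fin (n + 1) => b (k : ℕ) :=
  exists_nat_fun' 0 a

-- Splitting and contracting sequences of words

section
variable {n : ℕ}

theorem contractNth_same (k : Fin n) (s : Side) (a : Fin (n + 1) → MWord β) :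
    Fin.contractNth k.castSucc (MWord.op s) a k = MWord.op s (a k.castSucc) (a k.succ) := by
  simp [Fin.contractNth]

theorem contractNth_of_lt {k i : Fin n} (h : k < i) (s : Side) (a : Fin (n + 1) → MWord β) :
    Fin.contractNth i.castSucc (MWord.op s) a k = a k.castSucc := by
  have h' : (k : ℕ) < i := h
  simp [Fin.contractNth, h']

theorem splitNth_same (k : Fin n) (a : Fin n → MWord β) : splitNth k a k.castSucc = (a k).hd := by
  simp [splitNth]

theorem splitNth_succ (k : Fin n) (a : Fin n → MWord β) : splitNth k a k.succ = (a k).tl := by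
  simp [splitNth]

theorem splitNth_of_lt {k : Fin n} {j : ℕ} (h : j < k) (a : Fin n → MWord β) :
    splitNth k a ⟨j, by omega⟩ = a ⟨j, by omega⟩ := by
  simp [splitNth, h]

theorem contractNth_splitNth {k : Fin n} {a : Fin n → MWord β} (h : 2 ≤ (a k).len) :
    Fin.contractNth k.castSucc (MWord.op (a k).sp) (splitNth k a) = a := by
  obtain ⟨b, rfl⟩ := exists_nat_fun' k a
  ext1 j
  simp only [Fin.contractNth, splitNth, Fin.val_castSucc, Fin.val_succ]
  split_ifs <;> first | rfl | omega | skip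
  · have e : (j : ℕ) = k := by omega
    rw [e]
    exact MWord.op_hd_tl h

theorem contractNth_succ_splitNth {k i : Fin n} (hk : k < i) (q : Side)
    (a : Fin (n + 1) → MWord β) :
    Fin.contractNth i.succ.castSucc (MWord.op q) (splitNth k.castSucc a) =
      splitNth k (Fin.contractNth i.castSucc (MWord.op q) a) := by
  obtain ⟨b, rfl⟩ := exists_nat_fun a
  have h' : (k : ℕ) < i := hk
  ext1 j
  simp only [Fin.contractNth, splitNth, Fin.val_castSucc, Fin.val_succ]
  split_ifs <;> first | rfl | omega | skip
  · congr 2; omega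
  · congr 1; omega

theorem contractNth_succ_splitNth_same {k : Fin n} (q : Side) {a : Fin (n + 1) → MWord β}
    (h : 2 ≤ (a k.castSucc).len) :
    Fin.contractNth k.succ.castSucc (MWord.op ((a k.castSucc).sp.inner q))
        (splitNth k.castSucc a) =
      splitNth k (Fin.contractNth k.castSucc (MWord.op q) a) := by
  obtain ⟨b, rfl⟩ := exists_nat_fun a
  ext1 j
  simp only [Fin.contractNth, splitNth, Fin.val_castSucc, Fin.val_succ] at h ⊢
  split_ifs <;> first | rfl | omega | skip
  · exact (MWord.hd_op _ _ _).symm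
  · have e : (j : ℕ) = k + 1 := by omega
    rw [e]
    exact (MWord.tl_op h _ _).symm
  · congr 1; omega

theorem splitNth_contractNth {k : Fin n} {q : Side} {a : Fin (n + 1) → MWord β}
    (h : (a k.castSucc).len = 1) (hq : q ≠ .left ∨ (a k.succ).FirstMarked) :
    splitNth k (Fin.contractNth k.castSucc (MWord.op q) a) = a := by
  obtain ⟨b, rfl⟩ := exists_nat_fun a
  ext1 j
  simp only [Fin.contractNth, splitNth, Fin.val_castSucc, Fin.val_succ] at h hq ⊢
  split_ifs <;> first | rfl | omega | skip
  · have e : (j : ℕ) = k := by omega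
    rw [MWord.hd_op, MWord.hd_of_len h, e]
  · have e : (j : ℕ) = k + 1 := by omega
    rw [MWord.tl_op_of_len h hq, e]
  · congr 1; omega

end

-- Faces, degeneracies and stopping positions

section
variable {n : ℕ}

theorem d_snd_same (x : Cell β (n + 1)) (i : Fin n) :
    (d i x).2 i = MWord.op (x.1.side (i + 1)) (x.2 i.castSucc) (x.2 i.succ) :=
  contractNth_same _ _ _

theorem d_snd_of_lt (x : Cell β (n + 1)) {k i : Fin n} (h : k < i) :
    (d i x).2 k = x.2 k.castSucc :=
  contractNth_of_lt h _ _

theorem d_s {x : Cell β n} {k : Fin n} (h : Insertable (x.2 k).sp k x.1.1)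
    (hk : 2 ≤ (x.2 k).len) : d k (s k x) = x := by
  refine Prod.ext (T.face_ins h) ?_
  change Fin.contractNth _ (MWord.op ((x.1.ins _ _).side _)) _ = _
  rw [T.side_ins h]
  exact contractNth_splitNth hk

/-- For `i = k` tree and words both change by `outer` and `inner`, so the new leaf still carries the
operation of the new split. For `i > k` the two changes do not meet. -/
theorem d_succ_s {x : Cell β (n + 1)} {k i : Fin n} (h : LeftTo k x.1.1)
    (hk : 2 ≤ (x.2 k.castSucc).len) (hki : k ≤ i) :
    d i.succ (s k.castSucc x) = s k (d i x) := by
  have hi := i.2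
  rcases hki.eq_or_lt with rfl | hlt
  · refine Prod.ext ?_ ?_
    · change (x.1.ins _ (k : ℕ)).face (k + 2) = T.ins _ _ _
      rw [T.face_add_two_ins h, d_snd_same, MWord.sp_op hk]
      rfl
    · change Fin.contractNth _ (MWord.op ((x.1.ins _ (k : ℕ)).side (k + 2))) _ = _
      rw [T.side_add_two_ins h]
      exact contractNth_succ_splitNth_same _ hk
  · have hlt' : (k : ℕ) < i := hlt
    refine Prod.ext ?_ ?_
    · change (x.1.ins _ (k : ℕ)).face (i + 1 + 1) = T.ins _ _ _
      rw [T.face_succ_ins h (i := i + 1) (by omega) (by omega), d_snd_of_lt x hlt]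
      rfl
    · change Fin.contractNth _ (MWord.op ((x.1.ins _ (k : ℕ)).side (i + 1 + 1))) _ = _
      rw [T.side_ins_of_gt (j := i + 1) (h.insertable _) (by omega) (by omega)]
      exact contractNth_succ_splitNth hlt _ _

theorem two_le_len_d (x : Cell β (n + 1)) (i : Fin n) : 2 ≤ ((d i x).2 i).len := by
  rw [d_snd_same, MWord.len_op]
  have := (x.2 i.castSucc).len_pos
  have := (x.2 i.succ).len_pos
  omega

theorem stop_of_two_le {x : Cell β n} {k : Fin n} (h : 2 ≤ (x.2 k).len) : Stop k x :=
  ⟨k.2, .inl h⟩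

theorem stop_d (x : Cell β (n + 1)) (i : Fin n) : Stop i (d i x) :=
  stop_of_two_le (two_le_len_d x i)

/-- If the split is by ⊣, then insertion produces a special leaf and `tl` a word marked only at its
first letter: this is the normal form in `Stop`. -/
theorem stop_s {x : Cell β n} {k : Fin n} (h : LeftTo k x.1.1) (hk : 2 ≤ (x.2 k).len) :
    Stop k (s k x) := by
  refine ⟨by omega, .inr ⟨by omega, ?_⟩⟩
  have h1 : (s k x).1.side (k + 1) = (x.2 k).sp := T.side_ins (h.insertable _)
  rw [h1]
  by_cases hp : (x.2 k).sp = .left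
  · refine .inr ⟨?_, ?_⟩
    · have := h.special_ins
      rwa [← hp] at this
    · exact (congrArg MWord.FirstMarked (splitNth_succ k x.2)).mpr (MWord.firstMarked_tl hk hp)
  · exact .inl hp

/-- A cell which stops early still does so after a degeneracy is applied. -/
theorem exists_stop_s {x : Cell β n} {k : Fin n} (h : Insertable (x.2 k).sp k x.1.1)
    (hx : ∃ j < (k : ℕ), Stop j x) : ∃ j < (k : ℕ), Stop j (s k x) := by
  obtain ⟨j, hjk, hj, hst⟩ := hx
  refine ⟨j, hjk, by omega, ?_⟩
  rcases hst with hst | ⟨hj', hst⟩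
  · left
    exact hst.trans_eq (congrArg MWord.len (splitNth_of_lt hjk x.2).symm)
  · refine .inr ⟨by omega, ?_⟩
    by_cases hjk' : j + 1 < k
    · refine hst.imp (fun hs => ?_) fun hs => ⟨hs.1.ins_of_le _ (by omega), ?_⟩
      · have : (s k x).1.side (j + 1) = x.1.side (j + 1) := T.side_ins_of_lt h hjk' k.2
        rwa [this]
      · exact (congrArg MWord.FirstMarked (splitNth_of_lt hjk' x.2)).mpr hs.2
    -- Now `k = j + 1`: the word at `j + 1` is replaced by its first letter, and the insertion takes
    -- place at the leaf which determined `Stop j`.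
    · obtain ⟨k, hk⟩ := k
      obtain rfl : j + 1 = k := by simp only at hjk hjk'; omega
      right
      refine ⟨?_, ?_⟩
      · rcases hst with hst | hst
        · exact h.special_ins_of_side_ne _ hst
        · change Special j (x.1.1.ins _ (j + 1))
          rw [hst.2.sp]
          exact hst.1.ins_left_succ
      · exact (congrArg MWord.FirstMarked (splitNth_same ⟨j + 1, hk⟩ x.2)).mpr
          (MWord.firstMarked_of_len (MWord.len_hd _))

theorem leftTo_zero {n : ℕ} (t : T (n + 1)) : LeftTo 0 t.1 := by
  obtain ⟨t, ht⟩ := t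
  cases t with
  | leaf => simp [PTree.leaves] at ht
  | node t f => exact leftTo_zero_node t f

theorem leftTo_of_not_stop {x : Cell β n} {k : ℕ} (hk : k < n) (h : ∀ j < k, ¬ Stop j x) :
    LeftTo k x.1.1 := by
  induction k with
  | zero =>
    obtain ⟨n, rfl⟩ : ∃ m, n = m + 1 := ⟨n - 1, by omega⟩
    exact leftTo_zero x.1
  | succ k ih =>
    refine (ih (by omega) fun j hj => h j (by omega)).succ .middle ?_
    by_contra hs
    exact h k (by omega) ⟨by omega, .inr ⟨hk, .inl hs⟩⟩

/-- A cell that never stops has single letters as words, and all its leaves but the last are left.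
Its tree is then the right comb, so the cell would stop at `n`. -/
theorem exists_stop (x : Cell β (n + 2)) : ∃ k, Stop k x := by
  by_contra! h
  have h1 := leftTo_of_not_stop (k := n + 1) (by omega) fun j _ => h j
  refine h n ⟨by omega, .inr ⟨by omega, .inr ⟨h1.special_of_leaves x.1.2, ?_⟩⟩⟩
  apply MWord.firstMarked_of_len
  by_contra h2
  have := (x.2 ⟨n + 1, by omega⟩).len_pos
  exact h (n + 1) (stop_of_two_le (k := ⟨n + 1, by omega⟩) (by omega))

theorem insertable_d {x : Cell β (n + 1)} {k i : Fin n} (h : LeftTo k x.1.1) (hki : k ≤ i) :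
    Insertable ((d i x).2 k).sp k (d i x).1.1 := by
  rcases hki.eq_or_lt with rfl | hlt
  · refine h.insertable_del .middle _ (x.1.del_eq (k + 1)) fun hs => ?_
    change x.1.side (k + 1) = _ at hs
    rw [d_snd_same, hs]
    by_cases hl : (x.2 k.castSucc).len = 1
    · exact MWord.sp_op_of_len hl _ _
    · have := (x.2 k.castSucc).len_pos
      rw [MWord.sp_op (by omega)]
      cases (x.2 k.castSucc).sp <;> rfl
  · have hlt' : (k : ℕ) < i := hlt
    have hi := i.2
    exact (h.del (by omega) (by rw [x.1.2]; omega) (x.1.del_eq (i + 1))).insertable _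

/-- With a single letter at `k`, the product formed by `d` splits again into the same operation and,
by the second alternative of `Stop`, the same factor; likewise the leaf can be restored. -/
theorem s_d {x : Cell β (n + 1)} {k : ℕ} {hk : k < n + 1} (h : LeftTo k x.1.1) (hst : Stop k x)
    (hl : ¬ 2 ≤ (x.2 ⟨k, hk⟩).len) : ∃ i : Fin n, (i : ℕ) = k ∧ s i (d i x) = x := by
  obtain ⟨_, hst | ⟨hk', hst⟩⟩ := hst
  · exact absurd hst hl
  have hl1 : (x.2 ⟨k, hk⟩).len = 1 := by
    have := (x.2 ⟨k, hk⟩).len_pos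
    omega
  refine ⟨⟨k, by omega⟩, rfl, ?_⟩
  have hsp : ((d ⟨k, by omega⟩ x).2 ⟨k, by omega⟩).sp = x.1.side (k + 1) := by
    rw [d_snd_same]
    exact MWord.sp_op_of_len hl1 _ _
  refine Prod.ext (Subtype.ext ?_) ?_
  · change (x.1.face (k + 1)).1.ins ((d ⟨k, by omega⟩ x).2 ⟨k, by omega⟩).sp k = _
    rw [hsp]
    exact h.ins_del _ (x.1.del_eq _) (hst.imp_right And.left)
  · exact splitNth_contractNth hl1 (hst.imp_right And.right)

/-- Faces to the right of `k` of a cell stopping at `k` with a single letter again have a single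
letter there and stop there, so the matching contributes nothing at `k`. -/
theorem stop_d_of_short {x : Cell β (n + 1)} {k i : Fin n} (hst : Stop k x)
    (hl : ¬ 2 ≤ (x.2 k.castSucc).len) (hki : k < i) :
    Stop k (d i x) ∧ ¬ 2 ≤ ((d i x).2 k).len := by
  have hlt : (k : ℕ) < i := hki
  have hi := i.2
  obtain ⟨_, hst | ⟨hk', hst⟩⟩ := hst
  · exact absurd hst hl
  refine ⟨⟨k.2, .inr ⟨by omega, ?_⟩⟩, ?_⟩
  · by_cases hs : (x.1.face (i + 1)).side (k + 1) = .left
    swap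
    · exact .inl hs
    right
    by_cases hik : (k : ℕ) + 1 < i
    · have h1 := T.side_face_of_lt x.1 (k + 1) (i + 1) (by omega) (by omega)
      rw [hs] at h1
      rcases hst with hst | ⟨hst, hf⟩
      · exact absurd h1.symm hst
      · refine ⟨hst.del (by omega) (by rw [x.1.2]; omega) (x.1.del_eq (i + 1)), ?_⟩
        rw [d_snd_of_lt x (k := ⟨k + 1, by omega⟩) (by exact hik)]
        exact hf
    · have e : (i : ℕ) = k + 1 := by omega
      obtain ⟨i, hi'⟩ := i
      simp only at e
      subst e
      rcases hst with hst | ⟨hst, hf⟩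
      -- The relations of type `(x ∘ₚ y) ∘_q z = x ⊣ (y ∘ₛ z)` all have `p = left`, so a leaf that
      -- is not left cannot become left here.
      · have := x.1.compat (k + 1) (by omega)
        change (x.1.face (k + 1 + 1)).side (k + 1) = .left at hs
        rw [hs] at this
        revert hst this
        cases x.1.side (k + 1) <;> cases (x.1.face (k + 1)).side (k + 1) <;>
          simp [Compat]
      -- If leaf `k + 1` stays a left leaf, the deleted leaf was left too; the words at `k + 1` and
      -- `k + 2` are then multiplied by ⊣, and only the first mark survives.
      · rcases hst.del_add_two .middle (x.1.del_eq (k + 2)) with h1 | ⟨h1, h2⟩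
        · exact absurd hs h1
        · refine ⟨h2, ?_⟩
          change x.1.side (k + 2) = _ at h1
          rw [d_snd_same, h1]
          exact MWord.FirstMarked.op_left hf _
  · rwa [d_snd_of_lt x hki]

end

end Cell

/-! ### Acyclicity of the complex spanned by the cells -/

section
variable (K : Type u) [Field K] {β : Type v}

/-- The boundary map of the complex spanned by the cells. -/
noncomputable def cellBoundary (n : ℕ) : (Cell β (n + 1) →₀ K) →ₗ[K] (Cell β n →₀ K) :=
  ∑ i : Fin n, (-1 : K) ^ ((i : ℕ) + 1) • Finsupp.lmapDomain K K (Cell.d i)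

theorem cellBoundary_single {n : ℕ} (x : Cell β (n + 1)) :
    cellBoundary K n (Finsupp.single x 1) =
      ∑ i : Fin n, (-1 : K) ^ ((i : ℕ) + 1) • Finsupp.single (Cell.d i x) 1 := by
  simp [cellBoundary]

/-- The first position where the matching of a cell is determined carries a word with at least two
letters. -/
def Cell.IsLower {n : ℕ} (x : Cell β n) (k : Fin n) : Prop :=
  (∀ j < (k : ℕ), ¬ Cell.Stop j x) ∧ 2 ≤ (x.2 k).len

open Classical in
/-- The cell matched with a given one, with a sign. -/
noncomputable def cellMatch {n : ℕ} (x : Cell β n) : Cell β (n + 1) →₀ K :=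
  if h : ∃ k, x.IsLower k then
    (-1 : K) ^ ((h.choose : ℕ) + 1) • Finsupp.single (Cell.s h.choose x) 1 else 0

/-- A position as in `IsLower` is the first stopping position, hence unique. -/
theorem cellMatch_eq {n : ℕ} {x : Cell β n} {k : Fin n} (hk : x.IsLower k) :
    cellMatch K x = (-1 : K) ^ ((k : ℕ) + 1) • Finsupp.single (Cell.s k x) 1 := by
  have h : ∃ k, x.IsLower k := ⟨k, hk⟩
  have e : h.choose = k := by
    rcases lt_trichotomy h.choose k with hlt | heq | hgt
    · exact absurd (Cell.stop_of_two_le h.choose_spec.2) (hk.1 _ hlt)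
    · exact heq
    · exact absurd (Cell.stop_of_two_le hk.2) (h.choose_spec.1 _ hgt)
  rw [cellMatch, dif_pos h, e]

theorem cellMatch_eq_zero {n : ℕ} {x : Cell β n} {k : Fin n} (hk : ∀ j < (k : ℕ), ¬ Cell.Stop j x)
    (hst : Cell.Stop k x) (hl : ¬ 2 ≤ (x.2 k).len) : cellMatch K x = 0 := by
  rw [cellMatch, dif_neg]
  rintro ⟨l, h1, h2⟩
  rcases lt_trichotomy l k with hlt | rfl | hgt
  · exact hk _ hlt (Cell.stop_of_two_le h2)
  · exact hl h2
  · exact h1 _ hgt hst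

/-- The chains on the cells whose matching is determined before the position `k`. -/
noncomputable def stopBefore (β : Type v) (n k : ℕ) : Submodule K (Cell β n →₀ K) :=
  Finsupp.supported K K {x | ∃ j < k, Cell.Stop j x}

variable {K}

theorem single_mem_stopBefore {n k : ℕ} {x : Cell β n} (h : ∃ j < k, Cell.Stop j x) (c : K) :
    Finsupp.single x c ∈ stopBefore K β n k :=
  Finsupp.single_mem_supported K c h

theorem stopBefore_mono {n k l : ℕ} (h : k ≤ l) : stopBefore K β n k ≤ stopBefore K β n l :=
  Finsupp.supported_mono fun _ ⟨j, hj, hx⟩ => ⟨j, hj.trans_le h, hx⟩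

/-- The degeneracy is taken at the first stopping position, and the result stops there again. -/
theorem cellMatch_mem_stopBefore {n k : ℕ} {x : Cell β n} (h : ∃ j < k, Cell.Stop j x) :
    cellMatch K x ∈ stopBefore K β (n + 1) k := by
  by_cases hx : ∃ k, x.IsLower k
  · obtain ⟨l, hl⟩ := hx
    obtain ⟨j, hjk, hj⟩ := h
    rw [cellMatch_eq K hl]
    have hlj : (l : ℕ) ≤ j := by
      by_contra! hlt
      exact hl.1 j hlt hj
    exact Submodule.smul_mem _ _ (single_mem_stopBefore
      ⟨l, by omega, Cell.stop_s (Cell.leftTo_of_not_stop l.2 hl.1) hl.2⟩ 1)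
  · rw [cellMatch, dif_neg hx]
    exact Submodule.zero_mem _

variable (K) in
/-- The linear extension of the matching. -/
noncomputable def cellHomotopy (n : ℕ) : (Cell β n →₀ K) →ₗ[K] (Cell β (n + 1) →₀ K) :=
  Finsupp.linearCombination K (cellMatch K)

theorem cellHomotopy_single {n : ℕ} (x : Cell β n) :
    cellHomotopy K n (Finsupp.single x 1) = cellMatch K x := by
  simp [cellHomotopy]

/-- The face `d k` of `s k x` gives back `x`, the two signs cancelling. The other faces of `s k x`
are paired with the faces of `x`. -/
theorem homotopy_mem_of_isLower {n : ℕ} {x : Cell β (n + 1)} {k : Fin (n + 1)} (hk : x.IsLower k) :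
    Finsupp.single x 1 - cellBoundary K (n + 1) (cellMatch K x) -
      cellHomotopy K n (cellBoundary K n (Finsupp.single x 1)) ∈ stopBefore K β (n + 1) k := by
  have hleft := Cell.leftTo_of_not_stop k.2 hk.1
  rw [cellMatch_eq K hk, map_smul, cellBoundary_single, cellBoundary_single,
    Fin.sum_univ_succAbove _ k, Cell.d_s (hleft.insertable _) hk.2, map_sum, smul_add, smul_smul,
    ← pow_add, ← two_mul, pow_mul, neg_one_sq, one_pow, one_smul, sub_add_cancel_left,
    Finset.smul_sum, ← neg_add', ← Finset.sum_add_distrib]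
  refine Submodule.neg_mem _ (Submodule.sum_mem _ fun j _ => ?_)
  rw [map_smul, cellHomotopy_single]
  by_cases hjk : j.castSucc < k
  -- Faces at `j < k` have a long word at `j`, so they stop before `k`.
  · rw [Fin.succAbove_of_castSucc_lt _ _ hjk]
    have hjk' : (j : ℕ) < k := hjk
    refine Submodule.add_mem _ (Submodule.smul_mem _ _ (Submodule.smul_mem _ _ ?_))
      (Submodule.smul_mem _ _ ?_)
    · exact single_mem_stopBefore ⟨j, hjk', Cell.stop_d (Cell.s k x) j.castSucc⟩ 1
    · exact cellMatch_mem_stopBefore ⟨j, hjk', Cell.stop_d x j⟩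
  · obtain ⟨k, rfl⟩ : ∃ k' : Fin n, k = k'.castSucc := by
      have hjk' : (k : ℕ) ≤ j := not_lt.1 hjk
      exact ⟨⟨k, by omega⟩, rfl⟩
    have hjk' : k ≤ j := not_lt.1 hjk
    -- Here `d (j+1) (s k x) = s k (d j x)`. If `d j x` has no stop before `k`, this cancels against
    -- the match of `d j x`, the signs being opposite; otherwise both terms lie in the smaller
    -- filtration step.
    rw [Fin.succAbove_of_le_castSucc _ _ (not_lt.1 hjk), Cell.d_succ_s hleft hk.2 hjk']
    have hins := Cell.insertable_d hleft hjk'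
    by_cases hst : ∃ l < (k : ℕ), Cell.Stop l (Cell.d j x)
    · exact Submodule.add_mem _ (Submodule.smul_mem _ _ (Submodule.smul_mem _ _
          (single_mem_stopBefore (Cell.exists_stop_s hins hst) 1)))
        (Submodule.smul_mem _ _ (cellMatch_mem_stopBefore hst))
    · push Not at hst
      have hlong : 2 ≤ ((Cell.d j x).2 k).len := by
        rcases hjk'.eq_or_lt with rfl | hlt
        · exact Cell.two_le_len_d x k
        · rw [Cell.d_snd_of_lt x hlt]; exact hk.2
      rw [cellMatch_eq K ⟨hst, hlong⟩, smul_smul, smul_smul, ← add_smul]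
      convert Submodule.zero_mem _
      convert zero_smul K _
      simp only [Fin.val_castSucc, Fin.val_succ]
      ring

/-- Now `x` itself has no match, but it is the match of its face at `k`. The matches of all other
faces vanish or stop before `k`. -/
theorem homotopy_mem_of_short {n : ℕ} {x : Cell β (n + 1)} {k : Fin (n + 1)}
    (hk : ∀ j < (k : ℕ), ¬ Cell.Stop j x) (hst : Cell.Stop k x) (hl : ¬ 2 ≤ (x.2 k).len) :
    Finsupp.single x 1 - cellBoundary K (n + 1) (cellMatch K x) -
      cellHomotopy K n (cellBoundary K n (Finsupp.single x 1)) ∈ stopBefore K β (n + 1) k := by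
  have hleft := Cell.leftTo_of_not_stop k.2 hk
  obtain ⟨i, hi, hx⟩ := Cell.s_d hleft hst hl
  obtain rfl : k = i.castSucc := Fin.ext hi.symm
  have hins := Cell.insertable_d hleft (le_refl i)
  -- An earlier stop of the face would persist in its degeneracy, which is `x`.
  have hlow : (Cell.d i x).IsLower i := by
    refine ⟨fun j hj hst => ?_, Cell.two_le_len_d x i⟩
    obtain ⟨l, hl, hl'⟩ := Cell.exists_stop_s hins ⟨j, hj, hst⟩
    rw [hx] at hl'
    exact hk l hl hl'
  rw [cellMatch_eq_zero K hk hst hl, map_zero, sub_zero, cellBoundary_single, map_sum,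
    ← Finset.add_sum_erase _ _ (Finset.mem_univ i), map_smul, cellHomotopy_single,
    cellMatch_eq K hlow, hx, smul_smul, ← pow_add, ← two_mul, pow_mul, neg_one_sq, one_pow,
    one_smul, sub_add_cancel_left]
  refine Submodule.neg_mem _ (Submodule.sum_mem _ fun j hj => ?_)
  rw [map_smul, cellHomotopy_single]
  refine Submodule.smul_mem _ _ ?_
  rcases lt_or_gt_of_ne (Finset.ne_of_mem_erase hj) with hlt | hgt
  · exact cellMatch_mem_stopBefore ⟨j, hlt, Cell.stop_d x j⟩
  · obtain ⟨h1, h2⟩ := Cell.stop_d_of_short hst hl hgt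
    by_cases hst' : ∃ l < (i : ℕ), Cell.Stop l (Cell.d j x)
    · exact cellMatch_mem_stopBefore hst'
    · push Not at hst'
      rw [cellMatch_eq_zero K hst' h1 h2]
      exact Submodule.zero_mem _

theorem homotopy_mem {n k : ℕ} {z : Cell β (n + 1) →₀ K} (hz : z ∈ stopBefore K β (n + 1) (k + 1)) :
    z - cellBoundary K (n + 1) (cellHomotopy K (n + 1) z) -
      cellHomotopy K n (cellBoundary K n z) ∈ stopBefore K β (n + 1) k := by
  classical
  let N : (Cell β (n + 1) →₀ K) →ₗ[K] (Cell β (n + 1) →₀ K) :=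
    LinearMap.id - cellBoundary K (n + 1) ∘ₗ cellHomotopy K (n + 1) -
      cellHomotopy K n ∘ₗ cellBoundary K n
  suffices h : stopBefore K β (n + 1) (k + 1) ≤ (stopBefore K β (n + 1) k).comap N from h hz
  rw [stopBefore, Finsupp.supported_eq_span_single, Submodule.span_le]
  rintro _ ⟨x, hx, rfl⟩
  have hx' : ∃ j, Cell.Stop j x := let ⟨j, _, hj⟩ := hx; ⟨j, hj⟩
  obtain ⟨j, hjk, hj⟩ := hx
  have h1 : Nat.find hx' ≤ k := (Nat.find_min' hx' hj).trans (by omega)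
  have h2 := Nat.find_spec hx'
  have h3 : ∀ l < Nat.find hx', ¬ Cell.Stop l x := fun l hl => Nat.find_min hx' hl
  have h4 : Nat.find hx' < n + 1 := let ⟨h, _⟩ := h2; h
  refine stopBefore_mono h1 ?_
  change Finsupp.single x 1 - cellBoundary K (n + 1) (cellHomotopy K (n + 1) (Finsupp.single x 1)) -
    cellHomotopy K n (cellBoundary K n (Finsupp.single x 1)) ∈ _
  rw [cellHomotopy_single]
  by_cases hl : 2 ≤ (x.2 ⟨_, h4⟩).len
  · exact homotopy_mem_of_isLower (k := ⟨_, h4⟩) ⟨h3, hl⟩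
  · exact homotopy_mem_of_short (k := ⟨_, h4⟩) h3 h2 hl

/-- Subtracting `∂Hz` from a cycle `z` gives a cycle one step lower in the filtration, which starts
at zero and exhausts all chains. That `∂∂ = 0` is a hypothesis, as it is transported later from the
complex of the trialgebra. -/
theorem exists_cellBoundary_eq {n : ℕ} (hd : ∀ z : Cell β (n + 3) →₀ K,
      cellBoundary K (n + 1) (cellBoundary K (n + 2) z) = 0)
    (z : Cell β (n + 2) →₀ K) (hz : cellBoundary K (n + 1) z = 0) :
    ∃ y, cellBoundary K (n + 2) y = z := by
  suffices h : ∀ k, ∀ z ∈ stopBefore K β (n + 2) k, cellBoundary K (n + 1) z = 0 →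
      ∃ y, cellBoundary K (n + 2) y = z by
    refine h (n + 2) z (fun x _ => ?_) hz
    obtain ⟨k, hk⟩ := Cell.exists_stop x
    exact ⟨k, hk.1, hk⟩
  intro k
  induction k with
  | zero =>
    intro z hz _
    refine ⟨0, ?_⟩
    rw [map_zero]
    have : {x : Cell β (n + 2) | ∃ j < 0, Cell.Stop j x} = ∅ := by simp
    rw [stopBefore, this, Finsupp.supported_empty, Submodule.mem_bot] at hz
    exact hz.symm
  | succ k ih =>
    intro z hz hz'
    have h1 := homotopy_mem hz
    rw [hz', map_zero, sub_zero] at h1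
    obtain ⟨y, hy⟩ := ih _ h1 (by rw [map_sub, hz', hd, sub_zero])
    exact ⟨y + cellHomotopy K (n + 2) z, by rw [map_add, hy, sub_add_cancel]⟩

theorem single_mem_range_cellBoundary {x : Cell β 1} (h : 2 ≤ (x.2 0).len) :
    Finsupp.single x 1 ∈ LinearMap.range (cellBoundary K (β := β) 1) := by
  -- A cell of degree two has a single face, with sign `-1`.
  refine ⟨-Finsupp.single (Cell.s 0 x) 1, ?_⟩
  rw [map_neg, cellBoundary_single]
  simp [Cell.d_s ((Cell.leftTo_zero x.1).insertable _) h]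

end

/-! ### The basis of marked words of the free trialgebra -/

section
variable (K : Type u) (β : Type v) [Field K]

/-- The bilinear extension of the product of marked words. -/
noncomputable def wordMul (s : Side) :
    (MWord β →₀ K) →ₗ[K] (MWord β →₀ K) →ₗ[K] (MWord β →₀ K) :=
  Finsupp.linearCombination K fun x => Finsupp.lmapDomain K K fun y => MWord.op s x y

variable {K β}

theorem wordMul_single (s : Side) (x y : MWord β) :
    wordMul K β s (Finsupp.single x 1) (Finsupp.single y 1) = Finsupp.single (MWord.op s x y) 1 := by
  simp [wordMul]

theorem wordMul_assoc {p q r s : Side} (h : Compat p q r s) (x y z : MWord β →₀ K) :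
    wordMul K β q (wordMul K β p x y) z = wordMul K β r x (wordMul K β s y z) := by
  induction x using Finsupp.induction_linear with
  | zero => simp
  | add x x' hx hx' => simp only [map_add, LinearMap.add_apply, hx, hx']
  | single x a =>
    induction y using Finsupp.induction_linear with
    | zero => simp
    | add y y' hy hy' => simp only [map_add, LinearMap.add_apply, hy, hy']
    | single y b =>
      induction z using Finsupp.induction_linear with
      | zero => simp
      | add z z' hz hz' => simp only [map_add, hz, hz']
      | single z c =>
        rw [← Finsupp.smul_single_one x, ← Finsupp.smul_single_one y, ← Finsupp.smul_single_one z]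
        simp only [map_smul, LinearMap.smul_apply, wordMul_single, MWord.assoc h]

noncomputable instance : Trialgebra K (MWord β →₀ K) where
  left := wordMul K β .left
  right := wordMul K β .right
  mid := wordMul K β .middle
  left_left := wordMul_assoc trivial
  left_left_right := wordMul_assoc trivial
  right_left := wordMul_assoc trivial
  left_right := wordMul_assoc trivial
  right_right := wordMul_assoc trivial
  left_left_mid := wordMul_assoc trivial
  mid_left := wordMul_assoc trivial
  left_mid := wordMul_assoc trivial
  right_mid := wordMul_assoc trivial
  mid_right := wordMul_assoc trivial
  mid_mid := wordMul_assoc trivial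

theorem op_word (s : Side) : op K (A := MWord β →₀ K) s = wordMul K β s := by
  cases s <;> rfl

end

-- Evaluation of marked words in a trialgebra

section
variable {K : Type u} {β : Type v} {A : Type w} [Field K] [AddCommGroup A] [Module K A]
  [Trialgebra K A]

variable (K) in
/-- The product of the values of `f` at the letters of a word; the marks determine the operations. -/
def evalLetters (f : β → A) : List (β × Bool) → A
  | [] => 0
  | [c] => f c.1
  | c :: d :: l =>
    op K (if c.2 then if (d :: l).any Prod.snd then .middle else .left else .right) (f c.1)
      (evalLetters f (d :: l))

theorem left_op (s : Side) (x y z : A) :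
    op K .left x (op K s y z) = op K .left (op K .left x y) z :=
  (Compat.assoc (p := .left) (q := .left) (r := .left) (s := s) trivial x y z).symm

theorem right_op (s : Side) (x y z : A) :
    op K .right (op K s x y) z = op K .right x (op K .right y z) :=
  Compat.assoc (p := s) (q := .right) (r := .right) (s := .right) (by cases s <;> trivial) x y z

/-- To the right of ⊣ all operations are equivalent, so the marks of `l` do not matter.
`right_evalLetters` is the mirror statement for ⊢. -/
theorem left_evalLetters (f : β → A) (a : A) {l : List (β × Bool)} (hl : l ≠ []) :
    op K .left a (evalLetters K f l) = l.foldl (fun a c => op K .left a (f c.1)) a := by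
  induction l generalizing a with
  | nil => exact absurd rfl hl
  | cons c l ih =>
    cases l with
    | nil => rfl
    | cons d l => rw [evalLetters, left_op, ih _ (by simp)]; rfl

theorem right_evalLetters (f : β → A) (a : A) {l : List (β × Bool)} (hl : l ≠ []) :
    op K .right (evalLetters K f l) a = l.foldr (fun c a => op K .right (f c.1) a) a := by
  induction l with
  | nil => exact absurd rfl hl
  | cons c l ih =>
    cases l with
    | nil => rfl
    | cons d l => rw [evalLetters, right_op, ih (by simp)]; rfl

theorem evalLetters_cons (f : β → A) (c : β × Bool) {l : List (β × Bool)} (hl : l ≠ []) :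
    evalLetters K f (c :: l) =
      op K (if c.2 then if l.any Prod.snd then .middle else .left else .right) (f c.1)
        (evalLetters K f l) := by
  cases l with
  | nil => exact absurd rfl hl
  | cons d l => rw [evalLetters]

theorem ne_nil_of_any {l : List (β × Bool)} (h : l.any Prod.snd = true) : l ≠ [] := by
  rintro rfl; simp at h

theorem evalLetters_unmark_append (f : β → A) (x : List (β × Bool)) {y : List (β × Bool)}
    (hy : y ≠ []) :
    evalLetters K f (unmark x ++ y) =
      x.foldr (fun c a => op K .right (f c.1) a) (evalLetters K f y) := by
  induction x with
  | nil => rfl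
  | cons c x ih =>
    rw [unmark_cons, List.cons_append, evalLetters_cons f _ (by simp [hy]), ih]
    rfl

theorem foldl_unmark (f : β → A) (a : A) (l : List (β × Bool)) :
    (unmark l).foldl (fun a c => op K .left a (f c.1)) a =
      l.foldl (fun a c => op K .left a (f c.1)) a := by
  rw [unmark, List.foldl_map]

theorem unmark_ne_nil {l : List (β × Bool)} (h : l ≠ []) : unmark l ≠ [] := by
  simpa [unmark] using h

theorem evalLetters_append_unmark (f : β → A) {x y : List (β × Bool)}
    (hx : x.any Prod.snd = true) (hy : y ≠ []) :
    evalLetters K f (x ++ unmark y) = op K .left (evalLetters K f x) (evalLetters K f y) := by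
  induction x with
  | nil => simp at hx
  | cons c x ih =>
    obtain ⟨b, m⟩ := c
    have hy' := unmark_ne_nil hy
    rw [List.cons_append, evalLetters_cons f _ (by simp [hy'])]
    by_cases hx' : x.any Prod.snd = true
    · have h1 : (x ++ unmark y).any Prod.snd = true := by rw [List.any_append, hx']; rfl
      rw [evalLetters_cons f _ (ne_nil_of_any hx'), ih hx', h1, hx']
      cases m
      · exact (Trialgebra.right_left _ _ _).symm
      · exact (Trialgebra.mid_left _ _ _).symm
    · obtain rfl : m = true := by simpa [hx'] using hx
      have h1 : (x ++ unmark y).any Prod.snd = false := by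
        rw [List.any_append, Bool.eq_false_iff.2 hx']; simp
      rw [h1]
      -- Only the first letter is marked, so both sides are iterated products by ⊣ over the same
      -- letters.
      change op K .left _ _ = _
      rw [left_evalLetters f _ (by simp [hy']), List.foldl_append, foldl_unmark,
        left_evalLetters f _ hy]
      congr 1
      cases x with
      | nil => rfl
      | cons d x =>
        rw [evalLetters_cons f _ (by simp), Bool.eq_false_iff.2 hx']
        exact (left_evalLetters f _ (by simp)).symm

theorem evalLetters_append (f : β → A) {x y : List (β × Bool)}
    (hx : x.any Prod.snd = true) (hy : y.any Prod.snd = true) :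
    evalLetters K f (x ++ y) = op K .middle (evalLetters K f x) (evalLetters K f y) := by
  induction x with
  | nil => simp at hx
  | cons c x ih =>
    obtain ⟨b, m⟩ := c
    have hy' := ne_nil_of_any hy
    have h1 : (x ++ y).any Prod.snd = true := by rw [List.any_append, hy]; simp
    rw [List.cons_append, evalLetters_cons f _ (by simp [hy']), h1]
    by_cases hx' : x.any Prod.snd = true
    · rw [evalLetters_cons f _ (ne_nil_of_any hx'), ih hx', hx']
      cases m
      · exact (Trialgebra.right_mid _ _ _).symm
      · exact (Trialgebra.mid_mid _ _ _).symm
    · obtain rfl : m = true := by simpa [hx'] using hx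
      cases x with
      | nil => rfl
      | cons d x =>
        -- The remaining letters `d :: x` carry no mark, and the claim is the relation `(c ⊣ x) ⊥ y
        -- = c ⊥ (x ⊢ y)`.
        rw [← unmark_eq_self (Bool.eq_false_iff.2 hx'), evalLetters_unmark_append f _ hy',
          ← right_evalLetters f _ (by simp), evalLetters_cons f _ (unmark_ne_nil (by simp)),
          any_unmark, unmark_eq_self (Bool.eq_false_iff.2 hx')]
        exact (Trialgebra.left_mid _ _ _).symm

theorem evalLetters_op (f : β → A) (s : Side) (x y : MWord β) :
    evalLetters K f (MWord.op s x y).letters =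
      op K s (evalLetters K f x.letters) (evalLetters K f y.letters) := by
  cases s
  · exact evalLetters_append_unmark f x.marked (ne_nil_of_any y.marked)
  · exact evalLetters_append f x.marked y.marked
  · exact (evalLetters_unmark_append f _ (ne_nil_of_any y.marked)).trans
      (right_evalLetters f _ (ne_nil_of_any x.marked)).symm

variable (K) in
/-- The linear extension of the evaluation of words. -/
noncomputable def evalWords (f : β → A) : (MWord β →₀ K) →ₗ[K] A :=
  Finsupp.linearCombination K fun x => evalLetters K f x.letters

theorem evalWords_single (f : β → A) (x : MWord β) :
    evalWords K f (Finsupp.single x 1) = evalLetters K f x.letters := by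
  simp [evalWords]

theorem isHom_iff {B : Type*} [AddCommGroup B] [Module K B] [Trialgebra K B] {g : A →ₗ[K] B} :
    IsHom g ↔ ∀ s x y, g (op K s x y) = op K s (g x) (g y) :=
  ⟨fun h s => by cases s <;> [exact h.map_left; exact h.map_mid; exact h.map_right],
    fun h => ⟨h .left, h .right, h .middle⟩⟩

theorem isHom_evalWords (f : β → A) : IsHom (evalWords K f) := by
  refine isHom_iff.2 fun s x y => ?_
  rw [op_word]
  induction x using Finsupp.induction_linear with
  | zero => simp
  | add x x' hx hx' => simp only [map_add, LinearMap.add_apply, hx, hx']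
  | single x a =>
    induction y using Finsupp.induction_linear with
    | zero => simp
    | add y y' hy hy' => simp only [map_add, hy, hy']
    | single y b =>
      rw [← Finsupp.smul_single_one x, ← Finsupp.smul_single_one y]
      simp only [map_smul, LinearMap.smul_apply, wordMul_single, evalWords_single, evalLetters_op]

/-- `IsFree` tests only against trialgebras in the universe `max u v w`. A lifted copy of `A` makes
its uniqueness clause available for endomorphisms of `A`. -/
noncomputable instance : Trialgebra K (ULift.{v} A) :=
  let e : ULift.{v} A ≃ₗ[K] A := ULift.moduleEquiv
  let m (s : Side) : ULift.{v} A →ₗ[K] ULift.{v} A →ₗ[K] ULift.{v} A :=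
    ((op K s).compl₁₂ e.toLinearMap e.toLinearMap).compr₂ e.symm.toLinearMap
  have h {p q r s : Side} (h : Compat p q r s) (x y z : ULift.{v} A) :
      m q (m p x y) z = m r x (m s y z) := congrArg ULift.up (h.assoc x.down y.down z.down)
  { left := m .left
    right := m .right
    mid := m .middle
    left_left := h trivial
    left_left_right := h trivial
    right_left := h trivial
    left_right := h trivial
    right_right := h trivial
    left_left_mid := h trivial
    mid_left := h trivial
    left_mid := h trivial
    right_mid := h trivial
    mid_right := h trivial
    mid_mid := h trivial }

theorem isHom_up : IsHom (ULift.moduleEquiv.{u, w, v} (R := K) (M := A)).symm.toLinearMap :=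
  ⟨fun _ _ => rfl, fun _ _ => rfl, fun _ _ => rfl⟩

theorem IsHom.comp {B : Type*} {C : Type*} [AddCommGroup B] [Module K B] [Trialgebra K B]
    [AddCommGroup C] [Module K C] [Trialgebra K C] {g : B →ₗ[K] C} {f : A →ₗ[K] B}
    (hg : IsHom g) (hf : IsHom f) : IsHom (g ∘ₗ f) := by
  rw [isHom_iff] at *
  intro s x y
  simp [hf, hg]

theorem IsFree.hom_ext_self {V : Type v} [AddCommGroup V] [Module K V] {ι : V →ₗ[K] A}
    (hι : IsFree ι) {g : A →ₗ[K] A} (hg : IsHom g) (h : g ∘ₗ ι = ι) : g = .id := by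
  let e := (ULift.moduleEquiv.{u, w, max u v} (R := K) (M := A)).symm
  obtain ⟨_, -, hu⟩ := hι (ULift.{max u v} A) (e.toLinearMap ∘ₗ ι)
  have h1 := hu (e.toLinearMap ∘ₗ g) ⟨isHom_up.comp hg, by rw [LinearMap.comp_assoc, h]⟩
  have h2 := hu e.toLinearMap ⟨isHom_up, rfl⟩
  ext x
  exact e.injective (LinearMap.congr_fun (h1.trans h2.symm) x)

end

/-- The free trialgebra on a vector space with basis `β` has the marked words in `β` as a basis. -/
theorem IsFree.exists_basis {K : Type u} {V : Type v} {A : Type w} [Field K] [AddCommGroup V]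
    [Module K V] [AddCommGroup A] [Module K A] [Trialgebra K A] {ι : V →ₗ[K] A} (hι : IsFree ι)
    {β : Type (max v w)} (b : Module.Basis β K V) :
    ∃ c : Module.Basis (MWord β) K A,
      (∀ s x y, op K s (c x) (c y) = c (MWord.op s x y)) ∧ ∀ i, c (MWord.single i) = ι (b i) := by
  obtain ⟨g, ⟨hg, hgι⟩, -⟩ := hι (MWord β →₀ K)
    (b.constr K fun i => Finsupp.single (MWord.single i) 1)
  have hg' := isHom_iff.1 hg
  let h := evalWords K fun i => ι (b i)
  have hh := isHom_iff.1 (isHom_evalWords (K := K) fun i => ι (b i))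
  have hs : ∀ i, h (Finsupp.single (MWord.single i) 1) = ι (b i) := fun i => evalWords_single _ _
  have hgs : ∀ i, g (ι (b i)) = Finsupp.single (MWord.single i) 1 := fun i => by
    have := LinearMap.congr_fun hgι (b i)
    rwa [Module.Basis.constr_basis] at this
  -- Both composites of `g` and `h` are morphisms fixing the generators. On `A` this suffices by
  -- freeness; on words it is checked by induction on the length, splitting off the first letter.
  have h1 : h ∘ₗ g = .id := by
    refine hι.hom_ext_self ((isHom_evalWords _).comp hg) (b.ext fun i => ?_)
    simp only [LinearMap.comp_apply, hgs, hs]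
  have h2 : g ∘ₗ h = .id := by
    refine Finsupp.lhom_ext' fun x => LinearMap.ext_ring ?_
    simp only [LinearMap.comp_apply, Finsupp.lsingle_apply, LinearMap.id_apply]
    induction hn : x.len using Nat.strong_induction_on generalizing x with
    | _ n ih =>
      subst hn
      by_cases hx : 2 ≤ x.len
      · have hlt := MWord.len_tl hx
        have e : h (Finsupp.single x 1) =
            op K x.sp (h (Finsupp.single x.hd 1)) (h (Finsupp.single x.tl 1)) := by
          conv_lhs => rw [← MWord.op_hd_tl hx, ← wordMul_single, ← op_word]
          exact hh _ _ _
        rw [e, hg', ih _ (by rw [MWord.len_hd]; omega) _ rfl, ih _ (by omega) _ rfl, op_word,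
          wordMul_single, MWord.op_hd_tl hx]
      · obtain ⟨i, rfl⟩ := MWord.eq_single (x := x) (by have := x.len_pos; omega)
        rw [hs, hgs]
  refine ⟨⟨LinearEquiv.ofLinearMap g h h2 h1⟩, fun s x y => ?_, hs⟩
  change op K s (h (Finsupp.single x 1)) (h (Finsupp.single y 1)) = h (Finsupp.single _ 1)
  rw [← hh, op_word, wordMul_single]

/-! ### The homology of the free trialgebra -/

section
variable {K : Type u} {A : Type w} [Field K] [AddCommGroup A] [Module K A]
  {β : Type v}

/-- The basis of the space of chains induced by a basis of the trialgebra. -/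
noncomputable def chainsBasis (c : Module.Basis (MWord β) K A) (n : ℕ) :
    Module.Basis (Cell β n) K (Chains K A n) :=
  Finsupp.basisSingleOne.tensorProduct (Basis.piTensorProduct fun _ => c)

theorem chainsBasis_apply (c : Module.Basis (MWord β) K A) {n : ℕ} (x : Cell β n) :
    chainsBasis c n x = Finsupp.single x.1 1 ⊗ₜ PiTensorProduct.tprod K fun i => c (x.2 i) := by
  rw [chainsBasis, Module.Basis.tensorProduct_apply', Basis.piTensorProduct_apply,
    Finsupp.coe_basisSingleOne]

variable {V : Type*} [AddCommGroup V] [Module K V]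

/-- The map `v ↦ (Y; ι v)`. -/
noncomputable def chainOne (ι : V →ₗ[K] A) : V →ₗ[K] Chains K A 1 :=
  TensorProduct.mk K (T 1 →₀ K) (⨂[K]^1 A) (Finsupp.single Y 1) ∘ₗ
    (PiTensorProduct.subsingletonEquiv (R := K) (s := fun _ => A) (0 : Fin 1)).symm.toLinearMap ∘ₗ ι

theorem chainOne_apply (ι : V →ₗ[K] A) (v : V) :
    chainOne ι v = Finsupp.single Y 1 ⊗ₜ PiTensorProduct.tprod K fun _ : Fin 1 => ι v :=
  congrArg (Finsupp.single Y (1 : K) ⊗ₜ[K] ·) (PiTensorProduct.subsingletonEquiv_symm_apply' _ _)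

theorem chainOne_basis {c : Module.Basis (MWord β) K A} {ι : V →ₗ[K] A} {b : Module.Basis β K V}
    (hι : ∀ i, c (MWord.single i) = ι (b i)) (i : β) :
    chainOne ι (b i) = chainsBasis c 1 (Y, fun _ => MWord.single i) := by
  rw [chainsBasis_apply, chainOne_apply]
  simp only [hι]

variable [Trialgebra K A] {c : Module.Basis (MWord β) K A}

theorem face_chainsBasis (hc : ∀ s x y, op K s (c x) (c y) = c (MWord.op s x y)) {n : ℕ}
    (i : Fin n) (x : Cell β (n + 1)) :
    face K A i (chainsBasis c (n + 1) x) = chainsBasis c n (Cell.d i x) := by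
  rw [chainsBasis_apply, chainsBasis_apply, face_basis]
  congr 2
  ext j
  simp only [Cell.d, Fin.contractNth, hc]
  split_ifs <;> rfl

theorem boundary_eq_cellBoundary (hc : ∀ s x y, op K s (c x) (c y) = c (MWord.op s x y)) (n : ℕ) :
    boundary K A n ∘ₗ (chainsBasis c (n + 1)).repr.symm.toLinearMap =
      (chainsBasis c n).repr.symm.toLinearMap ∘ₗ cellBoundary K n := by
  refine Finsupp.lhom_ext' fun x => LinearMap.ext_ring ?_
  simp only [LinearMap.comp_apply, Finsupp.lsingle_apply, LinearEquiv.coe_coe,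
    Module.Basis.repr_symm_single_one, cellBoundary_single, map_sum, map_smul, boundary,
    LinearMap.sum_apply, LinearMap.smul_apply, face_chainsBasis hc]

/-- The basis of cells identifies both complexes, so `∂∂ = 0` passes from chains to cells and
exactness passes back. -/
theorem exists_boundary_eq (hc : ∀ s x y, op K s (c x) (c y) = c (MWord.op s x y)) {n : ℕ}
    (z : Chains K A (n + 2)) (hz : boundary K A (n + 1) z = 0) :
    ∃ y, boundary K A (n + 2) y = z := by
  have h (n : ℕ) (z) := LinearMap.congr_fun (boundary_eq_cellBoundary hc n) z
  simp only [LinearMap.comp_apply, LinearEquiv.coe_coe] at h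
  obtain ⟨z, rfl⟩ := (chainsBasis c (n + 2)).repr.symm.surjective z
  obtain ⟨y, rfl⟩ := exists_cellBoundary_eq (n := n) (fun y => by
      apply (chainsBasis c (n + 1)).repr.symm.injective
      rw [← h, ← h, map_zero]
      exact LinearMap.congr_fun (boundary_boundary K A (n + 1)) _) z (by
      apply (chainsBasis c (n + 1)).repr.symm.injective
      rw [← h, hz, map_zero])
  exact ⟨_, h _ _⟩

theorem T.eq_Y (t : T 1) : t = Y := by
  obtain ⟨t, ht⟩ := t
  apply Subtype.ext
  have pos : ∀ f : PForest, f.leaves = 1 → f = .one .leaf := by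
    intro f hf
    refine PForest.leaves_of_del_none (i := 0) ?_
    rcases h : f.del 0 with _ | f'
    · rfl
    · have := PForest.leaves_of_del_some h
      have := f'.leaves_pos
      omega
  cases t with
  | leaf => simp [PTree.leaves] at ht
  | node t f =>
    have := t.leaves_pos
    have := f.leaves_pos
    rw [PTree.leaves] at ht
    obtain rfl := pos f (by omega)
    have := pos (.one t) (by rw [PForest.leaves]; omega)
    obtain rfl := PForest.one.inj this
    rfl

/-- The vector given by a word consisting of a single letter; other words are mapped to zero. -/
def letter (b : β → V) (x : MWord β) : V :=
  match x.letters with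
  | [c] => b c.1
  | _ => 0

theorem letter_of_two_le (b : β → V) {x : MWord β} (h : 2 ≤ x.len) : letter b x = 0 := by
  obtain ⟨_, _, _, _, _, rfl⟩ := MWord.exists_cons_cons h
  rfl

/-- The projection `φ` onto words of length one kills boundaries, which consist of longer words, and
is a left inverse of `chainOne ι`. -/
theorem eq_zero_of_chainOne_mem_range (hc : ∀ s x y, op K s (c x) (c y) = c (MWord.op s x y))
    {ι : V →ₗ[K] A} {b : Module.Basis β K V} (hι : ∀ i, c (MWord.single i) = ι (b i)) {v : V}
    (hv : chainOne ι v ∈ LinearMap.range (boundary K A 1)) : v = 0 := by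
  let φ : Chains K A 1 →ₗ[K] V := (chainsBasis c 1).constr K fun x => letter b (x.2 0)
  have h1 : φ ∘ₗ boundary K A 1 = 0 := by
    refine (chainsBasis c 2).ext fun x => ?_
    simp only [LinearMap.comp_apply, boundary, LinearMap.sum_apply, LinearMap.smul_apply, map_sum,
      map_smul, face_chainsBasis hc, LinearMap.zero_apply]
    refine Finset.sum_eq_zero fun i _ => ?_
    rw [Module.Basis.constr_basis, Subsingleton.elim i 0,
      letter_of_two_le b (Cell.two_le_len_d x 0), smul_zero]
  have h2 : φ ∘ₗ chainOne ι = .id := by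
    refine b.ext fun i => ?_
    rw [LinearMap.comp_apply, chainOne_basis hι, Module.Basis.constr_basis]
    rfl
  obtain ⟨y, hy⟩ := hv
  rw [← LinearMap.id_apply (R := K) v, ← h2, LinearMap.comp_apply, ← hy]
  exact LinearMap.congr_fun h1 y

/-- A basis cell of degree one with a long word is the boundary of its split; one with a single
letter comes from `V`. -/
theorem exists_chainOne_add_boundary (hc : ∀ s x y, op K s (c x) (c y) = c (MWord.op s x y))
    {ι : V →ₗ[K] A} {b : Module.Basis β K V} (hι : ∀ i, c (MWord.single i) = ι (b i))
    (z : Chains K A 1) : ∃ v y, chainOne ι v + boundary K A 1 y = z := by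
  suffices h : ⊤ ≤ LinearMap.range (chainOne ι) ⊔ LinearMap.range (boundary K A 1) by
    obtain ⟨_, ⟨v, rfl⟩, _, ⟨y, rfl⟩, h⟩ := Submodule.mem_sup.1 (h (Submodule.mem_top (x := z)))
    exact ⟨v, y, h⟩
  rw [← (chainsBasis c 1).span_eq, Submodule.span_le]
  rintro _ ⟨x, rfl⟩
  by_cases hx : 2 ≤ (x.2 0).len
  · refine Submodule.mem_sup_right ?_
    obtain ⟨y, hy⟩ := single_mem_range_cellBoundary (K := K) hx
    have := LinearMap.congr_fun (boundary_eq_cellBoundary hc 1) y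
    rw [LinearMap.comp_apply, LinearMap.comp_apply, hy, LinearEquiv.coe_coe, LinearEquiv.coe_coe,
      Module.Basis.repr_symm_single_one] at this
    exact ⟨_, this⟩
  · refine Submodule.mem_sup_left ?_
    obtain ⟨i, hi⟩ := MWord.eq_single (x := x.2 0) (by have := (x.2 0).len_pos; omega)
    refine ⟨b i, ?_⟩
    rw [chainOne_basis hι]
    congr 1
    refine Prod.ext (T.eq_Y _).symm (funext fun j => ?_)
    rw [Subsingleton.elim j 0, hi]

end

-- From cycles and boundaries to the homology objects

section Homology

open CategoryTheory

variable (K : Type u) (A : Type w) [Field K] [AddCommGroup A] [Module K A] [Trialgebra K A]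

theorem chainComplex_d (n : ℕ) : (chainComplex K A).d (n + 1) n = chainMap K A n :=
  ChainComplex.of_d (chainModule K A) (chainMap K A) n

theorem isZero_homology_zero : Limits.IsZero ((chainComplex K A).homology 0) := by
  refine ShortComplex.isZero_homology_of_isZero_X₂ _ ?_
  exact ModuleCat.isZero_of_subsingleton (ModuleCat.of K PUnit)

theorem isZero_homology_of_exact {n : ℕ} (h : ∀ z : Chains K A (n + 2),
      boundary K A (n + 1) z = 0 → ∃ y, boundary K A (n + 2) y = z) :
    Limits.IsZero ((chainComplex K A).homology (n + 2)) := by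
  rw [← HomologicalComplex.exactAt_iff_isZero_homology,
    HomologicalComplex.exactAt_iff' _ (n + 3) (n + 2) (n + 1) (by simp) (by simp),
    ShortComplex.moduleCat_exact_iff]
  intro z hz
  change ((chainComplex K A).d (n + 2) (n + 1)).hom z = 0 at hz
  rw [chainComplex_d] at hz
  obtain ⟨y, hy⟩ := h z hz
  refine ⟨y, ?_⟩
  change ((chainComplex K A).d (n + 3) (n + 2)).hom y = z
  rw [chainComplex_d]
  exact hy

/-- Since the differential out of degree one is zero, lifting to cycles is an isomorphism, with
inverse `iCycles`. -/
theorem homologyClassOne_surjective : Function.Surjective (homologyClassOne K A) := by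
  let f := (chainComplex K A).liftCycles (𝟙 ((chainComplex K A).X 1)) 0 (by simp)
    (by rw [chainComplex_d_one_zero]; exact Limits.comp_zero)
  have hf : IsIso f := ⟨(chainComplex K A).iCycles 1, by simp [f], by
    rw [← cancel_mono ((chainComplex K A).iCycles 1)]; simp [f]⟩
  exact (ModuleCat.epi_iff_surjective (f ≫ (chainComplex K A).homologyπ 1)).1 inferInstance

theorem homologyClassOne_eq_zero_iff (z : Chains K A 1) :
    homologyClassOne K A z = 0 ↔ z ∈ LinearMap.range (boundary K A 1) := by
  let C := chainComplex K A
  let f := C.liftCycles (𝟙 (C.X 1)) 0 (by simp)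
    (by rw [chainComplex_d_one_zero]; exact Limits.comp_zero)
  have hf : ∀ z, (C.iCycles 1).hom (f.hom z) = z := fun z => by
    have : f ≫ C.iCycles 1 = 𝟙 _ := C.liftCycles_i _ _ _ _
    exact LinearMap.congr_fun (congrArg ModuleCat.Hom.hom this) z
  have hi : Function.Injective (C.iCycles 1).hom :=
    (ModuleCat.mono_iff_injective (C.iCycles 1)).1 inferInstance
  have hd : ∀ y, (C.iCycles 1).hom ((C.toCycles 2 1).hom y) = boundary K A 1 y := fun y => by
    have : C.toCycles 2 1 ≫ C.iCycles 1 = chainMap K A 1 :=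
      (C.toCycles_i 2 1).trans (chainComplex_d K A 1)
    exact LinearMap.congr_fun (congrArg ModuleCat.Hom.hom this) y
  have hex : (ShortComplex.mk (C.toCycles 2 1) (C.homologyπ 1) (by simp)).Exact :=
    ShortComplex.exact_of_g_is_cokernel _ (C.homologyIsCokernel 2 1 (by simp))
  rw [ShortComplex.moduleCat_exact_iff] at hex
  constructor
  · intro hz
    obtain ⟨y, hy⟩ := hex (f.hom z) hz
    refine ⟨y, ?_⟩
    rw [← hd, ← hf z]
    exact congrArg _ hy
  · rintro ⟨y, rfl⟩
    have : f.hom (boundary K A 1 y) = (C.toCycles 2 1).hom y := 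
      hi ((hf _).trans (hd y).symm)
    change (C.homologyπ 1).hom (f.hom (boundary K A 1 y)) = 0
    rw [this]
    exact LinearMap.congr_fun (congrArg ModuleCat.Hom.hom (C.toCycles_comp_homologyπ 2 1)) y

end Homology

end Trias

theorem theorem4p1 {K : Type u} {V : Type v} {A : Type w} [Field K] [AddCommGroup V] [Module K V]
    [AddCommGroup A] [Module K A] [Trias.Trialgebra K A] (ι : V →ₗ[K] A) (hι : Trias.IsFree ι) :
    (∃ e : V ≃ₗ[K] (Trias.chainComplex K A).homology 1, ∀ v : V,
      e v = Trias.homologyClassOne K A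
        (Finsupp.single Trias.Y 1 ⊗ₜ[K] PiTensorProduct.tprod K fun _ : Fin 1 => ι v)) ∧
    ∀ n : ℕ, n ≠ 1 → CategoryTheory.Limits.IsZero ((Trias.chainComplex K A).homology n) := by
  -- The index type is lifted so that combinations of marked words live in the universe over which
  -- `IsFree` quantifies.
  let b := (Module.Basis.ofVectorSpace K V).reindex Equiv.ulift.{w}.symm
  obtain ⟨c, hc, hb⟩ := hι.exists_basis b
  constructor
  · let h := Trias.homologyClassOne K A ∘ₗ Trias.chainOne ι
    refine ⟨LinearEquiv.ofBijective h ⟨?_, fun y => ?_⟩, fun v => ?_⟩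
    rotate_right
    · rw [← Trias.chainOne_apply]; rfl
    · refine (injective_iff_map_eq_zero h).2 fun v hv => ?_
      exact Trias.eq_zero_of_chainOne_mem_range hc hb
        ((Trias.homologyClassOne_eq_zero_iff K A _).1 hv)
    · obtain ⟨z, rfl⟩ := Trias.homologyClassOne_surjective K A y
      obtain ⟨v, y, rfl⟩ := Trias.exists_chainOne_add_boundary hc hb z
      refine ⟨v, ?_⟩
      rw [map_add, (Trias.homologyClassOne_eq_zero_iff K A _).2 ⟨y, rfl⟩, add_zero]
      rfl
  · rintro (_ | _ | n) hn
    · exact Trias.isZero_homology_zero K A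
    · exact absurd rfl hn
    · exact Trias.isZero_homology_of_exact K A (Trias.exists_boundary_eq hc)
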